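/- Let $n,k$ be integers with $1\le k<n$, let $1<p<k+1$ and $0<\gamma<2(p-1)/k$. Let $(\mathbb S^n,g,\nabla)$ be the unit sphere in $\mathbb R^{n+1}$ with its round metric and Levi-Civita connection. For a function $s$ on $\mathbb S^n$ put $\tau[s]=\nabla^2 s+s\,g$, and let $\sigma_j(\tau[s])$ be the $j$-th elementary symmetric function of the eigenvalues of $\tau[s]$ with respect to $g$. Let $\|h\|_{C^2}=\sup|h|+\sup|\nabla h|+\sup|\nabla^2h|$. Let $f\in C^2(\mathbb S^n)$ be positive, and let $s\in C^4(\mathbb S^n)$ be even ($s(-x)=s(x)$) with $\tau[s]>0$ (such an $s$ is automatically positive) and $$\frac{\sigma_n}{\sigma_{n-k}}(\tau[s])=s^{p-1}f\quad\text{on }\mathbb S^n .$$ Then $$\frac1C\le s\le C,\qquad \nabla^2 s+s\,g\ \ge\ \frac1C\,g,\qquad \|s\|_{C^2}\le C,$$ where $C>0$ depends only on $n,k,p,\gamma$, $\min f$ and $\|f\|_{C^2}$; more precisely, for all $m>0$ and $M$ one constant $C=C(n,k,p,\gamma,m,M)$ works for all such $f$ with $\min f\ge m$ and $\|f\|_{C^2}\le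 M$ and all such $s$. -/

import Mathlib

open scoped Manifold ContDiff

noncomputable section

/-- The ambient Euclidean space of dimension `n + 1`. -/
abbrev Amb (n : ℕ) : Type := EuclideanSpace ℝ (Fin (n + 1))

/-- The unit sphere of dimension `n`, with Mathlib's manifold structure. -/
abbrev Sph (n : ℕ) : Type := Metric.sphere (0 : Amb n) 1

/-- The tangent space of the sphere at `x`, realised as the orthogonal complement of `x`. With the
induced inner product this is the tangent space with the round metric `g`. -/
abbrev TanSp {n : ℕ} (x : Sph n) : Submodule ℝ (Amb n) :=
  (Submodule.span ℝ {(x : Amb n)})ᗮ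

/-- The radially constant extension `y ↦ s (y / ‖y‖)` of a function on the sphere
(with value `0` at the origin). -/
def radialExt {n : ℕ} (s : Sph n → ℝ) (y : Amb n) : ℝ :=
  if hy : y ≠ 0 then
    s ⟨‖y‖⁻¹ • y, by simp [norm_smul, inv_mul_cancel₀ (norm_ne_zero_iff.mpr hy)]⟩
  else 0

/-- The vector field `∇ s`, extended off the sphere. At a point `x` of the sphere it is the
Riemannian gradient of `s`: it represents `ds` on tangent vectors, and it is tangent to the sphere
because the extension of `s` is radially constant. -/
def sphereGrad {n : ℕ} (s : Sph n → ℝ) : Amb n → Amb n :=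
  gradient (radialExt s)

/-- The covariant Hessian `∇² s` at `x`, as the endomorphism `u ↦ ∇_u (∇ s)` of the tangent space.
The Levi-Civita connection of the round metric is the tangential projection of the
ambient derivative. As a bilinear form the Hessian is `(u, v) ↦ ⟪∇_u (∇ s), v⟫`. -/
def sphereHess {n : ℕ} (s : Sph n → ℝ) (x : Sph n) : TanSp x →L[ℝ] TanSp x :=
  (TanSp x).orthogonalProjectionOnto ∘L fderiv ℝ (sphereGrad s) (x : Amb n) ∘L (TanSp x).subtypeL

/-- `τ[s] = ∇² s + s g` at `x`, as an endomorphism of the tangent space (index raised with `g`). -/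
def tau {n : ℕ} (s : Sph n → ℝ) (x : Sph n) : TanSp x →L[ℝ] TanSp x :=
  sphereHess s x + s x • ContinuousLinearMap.id ℝ (TanSp x)

/-- `σ_j`: the `j`-th elementary symmetric function of the eigenvalues of an endomorphism, counted
with multiplicity. -/
def sigma {V : Type*} [AddCommGroup V] [Module ℝ V] [Module.Finite ℝ V] [Module.Free ℝ V]
    (j : ℕ) (A : V →ₗ[ℝ] V) : ℝ :=
  A.charpoly.roots.esymm j

/-- The norm `‖s‖_{C²} = sup |s| + sup |∇ s| + sup |∇² s|` for the round metric. -/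
def c2Norm {n : ℕ} (s : Sph n → ℝ) : ℝ :=
  (⨆ x : Sph n, |s x|) + (⨆ x : Sph n, ‖sphereGrad s (x : Amb n)‖) +
    ⨆ x : Sph n, ‖sphereHess s x‖

/-- `s` is even. -/
def IsEven {n : ℕ} (s : Sph n → ℝ) : Prop := ∀ x : Sph n, s (-x) = s x

/-- `a g ≤ τ[s]` as quadratic forms, at every point. -/
def TauGe {n : ℕ} (s : Sph n → ℝ) (a : ℝ) : Prop :=
  ∀ (x : Sph n) (u : TanSp x), a * ‖u‖ ^ 2 ≤ inner ℝ (tau s x u) u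

/-- `τ[s] > 0` at every point. -/
def TauPos {n : ℕ} (s : Sph n → ℝ) : Prop :=
  ∀ (x : Sph n) (u : TanSp x), u ≠ 0 → 0 < inner ℝ (tau s x u) u

/-- The equation `σ_n / σ_{n-k} (τ[s]) = s ^ (p - 1) f` on the sphere. -/
def SolvesEq {n : ℕ} (k : ℕ) (p : ℝ) (f s : Sph n → ℝ) : Prop :=
  ∀ x : Sph n, sigma n (tau s x : TanSp x →ₗ[ℝ] TanSp x) /
    sigma (n - k) (tau s x : TanSp x →ₗ[ℝ] TanSp x) = s x ^ (p - 1) * f x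

end

/-! Write `Q = e_k(1/λ)` for the `k`-th elementary symmetric function of the reciprocal eigenvalues
of `τ[s]`. Then `σ_n/σ_{n-k} = 1/Q`, and `-log Q` is concave, increasing in each `λ_i`, and shifts
by `k log c` when `λ` is scaled by `c`. Everything is computed on the one-homogeneous extension of
`s` to the ambient space: its Hessian restricted to tangent vectors is `τ[s]`, it kills the radial
direction, and its partial derivatives commute, so curvature terms arise only from homogeneity.

The operator function is never differentiated. By `log_sigma_div_sigma_le`, it lies below its
tangent plane at a diagonal operator. Along a line in an eigendirection, the logarithm of the
equation therefore stays below an expression linear in the Hessian, with equality at the base point.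
The first and second derivative tests at that contact point give the once differentiated equation,
as an equality, and the twice differentiated one, as an inequality (`IsEigenframe.derivatives`).

Zeroth and first order. At a maximum of `s` all `λ_i ≤ s`, and at a minimum all `λ_i ≥ s`; since `p
< k + 1`, the equation bounds `max s` below and `min s` above. The missing bounds follow from `min s
≥ c max s`. To get this, the maximum principle is applied to `log (s² + |∇s|²) - γ log s`; the
condition `γ < 2(p-1)/k` lets the term `2(p-1)|∇s|²` absorb `γ k |∇s|²` (`gradSq_le_at_max`). Hence
`s^(1-γ/2)` is Lipschitz with constant of order `(max s)^(1-γ/2)`. By evenness and convexity, `s(z)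
≥ max s · |⟨z, x₀⟩|` for a maximum point `x₀`, so `s` can be small only near the equator of `x₀`. At
distance `t` from there `s` is at least of order `t max s`, whereas the Lipschitz bound allows
`s^(1-γ/2)` to grow only linearly in `t`; for small `t` this forces a lower bound
(`exists_mul_max_le`).

Second order. Where the largest eigenvalue of `τ[s]` is maximal, commuting fourth derivatives turns
the twice differentiated equation into a bound for `Λ ∑ F_i`, where `F_i` are the partial
derivatives of `-log Q`. The upper bound on `s^(p-1) f` keeps `Q`, hence `∑ F_i`, away from zero
(`le_sum_invWeight`), so `Λ` is bounded. The lower bound on `s^(p-1) f` bounds `Q` above and then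
keeps every eigenvalue away from zero (`le_mul_invEsymm`). -/

open scoped Topology

/-! ### The curvature function of the eigenvalues: concavity and bounds. -/

open Finset in
/-- The `k`-th elementary symmetric function of the reciprocals of `l`. -/
noncomputable def invEsymm {ι : Type*} [Fintype ι] (k : ℕ) (l : ι → ℝ) : ℝ :=
  ∑ S ∈ powersetCard k (univ : Finset ι), ∏ i ∈ S, (l i)⁻¹

open Finset in
/-- The partial derivative of `-log (invEsymm k l)` in the `i`-th variable. -/
noncomputable def invWeight {ι : Type*} [Fintype ι] [DecidableEq ι] (k : ℕ) (l : ι → ℝ)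
    (i : ι) : ℝ :=
  (∑ S ∈ powersetCard k (univ : Finset ι), if i ∈ S then ∏ j ∈ S, (l j)⁻¹ else 0) /
    invEsymm k l * (l i)⁻¹

section InvEsymm

open Finset

set_option linter.unusedSectionVars false

variable {ι : Type*} [Fintype ι] [DecidableEq ι] {k : ℕ} {l : ι → ℝ}

theorem invEsymm_pos (hk : k ≤ Fintype.card ι) (hl : ∀ i, 0 < l i) : 0 < invEsymm k l := by
  refine sum_pos (fun S _ => prod_pos fun i _ => inv_pos.2 (hl i)) ?_
  exact powersetCard_nonempty.2 (by simpa using hk)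

theorem sum_invWeight_mul (a : ι → ℝ) :
    ∑ i, invWeight k l i * a i =
      (∑ S ∈ powersetCard k (univ : Finset ι),
        (∏ j ∈ S, (l j)⁻¹) * ∑ i ∈ S, (l i)⁻¹ * a i) / invEsymm k l := by
  have h : ∀ i, invWeight k l i * a i =
      (∑ S ∈ powersetCard k (univ : Finset ι),
        if i ∈ S then (∏ j ∈ S, (l j)⁻¹) * ((l i)⁻¹ * a i) else 0) / invEsymm k l := by
    intro i
    rw [invWeight, div_mul_eq_mul_div, div_mul_eq_mul_div, mul_assoc, sum_mul]
    congr 1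
    exact sum_congr rfl fun S _ => by split_ifs <;> simp
  simp_rw [h, ← sum_div]
  rw [sum_comm]
  congr 1
  refine sum_congr rfl fun S _ => ?_
  rw [mul_sum, ← sum_filter]
  simp

theorem invWeight_nonneg (hk : k ≤ Fintype.card ι) (hl : ∀ i, 0 < l i) (i : ι) :
    0 ≤ invWeight k l i := by
  refine mul_nonneg (div_nonneg (sum_nonneg fun S _ => ?_) (invEsymm_pos hk hl).le)
    (inv_pos.2 (hl i)).le
  split_ifs
  · exact prod_nonneg fun j _ => (inv_pos.2 (hl j)).le
  · exact le_rfl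

/-- Euler's identity: `1 / invEsymm k` is homogeneous of degree `k`, and the weights are the partial
derivatives of its logarithm. -/
theorem sum_invWeight_mul_self (hk : k ≤ Fintype.card ι) (hl : ∀ i, 0 < l i) :
    ∑ i, invWeight k l i * l i = k := by
  rw [sum_invWeight_mul, div_eq_iff (invEsymm_pos hk hl).ne', invEsymm, mul_sum]
  refine sum_congr rfl fun S hS => ?_
  rw [sum_congr rfl fun i _ => inv_mul_cancel₀ (hl i).ne']
  simp [(mem_powersetCard.1 hS).2, mul_comm]

/-- The tangent plane inequality for the concave function `-log (invEsymm k)`. -/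
theorem neg_log_invEsymm_le (hk : k ≤ Fintype.card ι) (hl : ∀ i, 0 < l i) {a : ι → ℝ}
    (ha : ∀ i, 0 < a i) :
    -Real.log (invEsymm k a) ≤
      -Real.log (invEsymm k l) + ∑ i, invWeight k l i * (a i - l i) := by
  have hql := invEsymm_pos hk hl
  have hqa := invEsymm_pos hk ha
  set z : ℝ := ∑ i, invWeight k l i * (l i - a i) with hz
  have hz' : ∑ i, invWeight k l i * (a i - l i) = -z := by
    rw [hz, ← sum_neg_distrib]
    exact sum_congr rfl fun i _ => by ring
  -- Jensen's inequality for `exp`, with weights `∏ (l i)⁻¹`. The tangent to `exp` is taken at the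
  -- weighted mean `z` of the exponents, so the linear terms cancel on summing over `S`.
  have key : invEsymm k l * Real.exp z ≤ invEsymm k a := by
    have hS : ∀ S ∈ powersetCard k (univ : Finset ι),
        (∏ i ∈ S, (l i)⁻¹) * (Real.exp z * (1 + (∑ i ∈ S, (l i)⁻¹ * (l i - a i)) - z)) ≤
          ∏ i ∈ S, (a i)⁻¹ := by
      intro S _
      have h1 : ∏ i ∈ S, (a i)⁻¹ = (∏ i ∈ S, (l i)⁻¹) * ∏ i ∈ S, (l i / a i) := by
        rw [← prod_mul_distrib]
        refine prod_congr rfl fun i _ => ?_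
        have := (hl i).ne'; have := (ha i).ne'
        field_simp
      rw [h1]
      refine mul_le_mul_of_nonneg_left ?_ (prod_nonneg fun i _ => (inv_pos.2 (hl i)).le)
      calc Real.exp z * (1 + (∑ i ∈ S, (l i)⁻¹ * (l i - a i)) - z)
          ≤ Real.exp z * Real.exp ((∑ i ∈ S, (l i)⁻¹ * (l i - a i)) - z) := by
            refine mul_le_mul_of_nonneg_left ?_ (Real.exp_pos _).le
            have := Real.add_one_le_exp ((∑ i ∈ S, (l i)⁻¹ * (l i - a i)) - z)
            linarith
        _ = ∏ i ∈ S, Real.exp ((l i)⁻¹ * (l i - a i)) := by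
            rw [← Real.exp_add, ← Real.exp_sum]; congr 1; ring
        _ ≤ ∏ i ∈ S, (l i / a i) := by
            refine prod_le_prod (fun i _ => (Real.exp_pos _).le) fun i _ => ?_
            have h2 : (l i)⁻¹ * (l i - a i) = 1 - (l i / a i)⁻¹ := by
              have := (hl i).ne'; have := (ha i).ne'
              field_simp
            have h3 : 0 < l i / a i := div_pos (hl i) (ha i)
            rw [h2, ← Real.le_log_iff_exp_le h3]
            exact Real.one_sub_inv_le_log_of_pos h3
    have hsum := sum_le_sum hS
    refine le_trans (le_of_eq ?_) hsum
    have h4 : (∑ S ∈ powersetCard k (univ : Finset ι),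
        (∏ j ∈ S, (l j)⁻¹) * ∑ i ∈ S, (l i)⁻¹ * (l i - a i)) = z * invEsymm k l := by
      rw [hz, sum_invWeight_mul, div_mul_cancel₀ _ hql.ne']
    have h5 : ∀ S ∈ powersetCard k (univ : Finset ι), (∏ i ∈ S, (l i)⁻¹) *
        (Real.exp z * (1 + (∑ i ∈ S, (l i)⁻¹ * (l i - a i)) - z)) =
        Real.exp z * ((1 - z) * (∏ i ∈ S, (l i)⁻¹) +
          (∏ i ∈ S, (l i)⁻¹) * ∑ i ∈ S, (l i)⁻¹ * (l i - a i)) := fun S _ => by ring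
    rw [sum_congr rfl h5, ← mul_sum, sum_add_distrib, ← mul_sum, h4, invEsymm]
    ring
  have := Real.log_le_log (by positivity) key
  rw [Real.log_mul hql.ne' (Real.exp_pos _).ne', Real.log_exp] at this
  rw [hz']; linarith

theorem invEsymm_comp_perm (σ : Equiv.Perm ι) : invEsymm k (l ∘ σ) = invEsymm k l := by
  unfold invEsymm
  refine sum_bij (fun S _ => S.map σ.toEmbedding) ?_ ?_ ?_ ?_
  · intro S hS; simpa [mem_powersetCard] using hS
  · intro S _ T _ h; exact map_injective _ h
  · intro T hT
    refine ⟨T.map σ.symm.toEmbedding, by simpa [mem_powersetCard] using hT, ?_⟩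
    ext x; simp
  · intro S _; simp

/-- The tangent plane inequality after averaging with a doubly stochastic matrix. -/
theorem neg_log_invEsymm_le_of_doublyStochastic (hk : k ≤ Fintype.card ι) (hl : ∀ i, 0 < l i)
    {a : ι → ℝ} (ha : ∀ i, 0 < a i) {P : Matrix ι ι ℝ} (hP : P ∈ doublyStochastic ℝ ι) :
    -Real.log (invEsymm k a) ≤
      -Real.log (invEsymm k l) + ∑ i, invWeight k l i * (P.mulVec a i - l i) := by
  -- Birkhoff: a doubly stochastic matrix is a convex combination of permutation matrices, and
  -- `invEsymm` is symmetric, so the permuted inequalities can be averaged.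
  obtain ⟨w, hw0, hw1, rfl⟩ := exists_eq_sum_perm_of_mem_doublyStochastic hP
  have h1 : ∀ σ : Equiv.Perm ι, w σ * -Real.log (invEsymm k a) ≤
      w σ * (-Real.log (invEsymm k l) + ∑ i, invWeight k l i * (a (σ i) - l i)) := by
    intro σ
    refine mul_le_mul_of_nonneg_left ?_ (hw0 σ)
    rw [← invEsymm_comp_perm (l := a) σ]
    exact neg_log_invEsymm_le hk hl fun i => ha _
  have h2 := sum_le_sum fun σ (_ : σ ∈ (univ : Finset (Equiv.Perm ι))) => h1 σ
  rw [← sum_mul, hw1, one_mul] at h2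
  refine h2.trans (le_of_eq ?_)
  simp_rw [mul_add]
  rw [sum_add_distrib, ← sum_mul, hw1, one_mul]
  congr 1
  simp_rw [mul_sum]
  rw [sum_comm]
  refine sum_congr rfl fun i _ => ?_
  have h3 : (∑ σ, w σ • σ.permMatrix ℝ).mulVec a i = ∑ σ, w σ * a (σ i) := by
    simp [Matrix.sum_mulVec, Matrix.smul_mulVec, Matrix.permMatrix_mulVec]
  have h4 : l i = ∑ σ, w σ * l i := by rw [← sum_mul, hw1, one_mul]
  rw [h3]
  conv_rhs => rw [h4]
  rw [← sum_sub_distrib, mul_sum]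
  exact sum_congr rfl fun σ _ => by ring

theorem invEsymm_le_of_le (hl : ∀ i, 0 < l i) {c : ℝ} (hc : 0 < c) (h : ∀ i, c ≤ l i) :
    invEsymm k l ≤ (Fintype.card ι).choose k * (c⁻¹) ^ k := by
  unfold invEsymm
  have : ∀ S ∈ powersetCard k (univ : Finset ι), ∏ i ∈ S, (l i)⁻¹ ≤ (c⁻¹) ^ k := by
    intro S hS
    rw [← (mem_powersetCard.1 hS).2, ← prod_const]
    exact prod_le_prod (fun i _ => (inv_pos.2 (hl i)).le) fun i _ => inv_anti₀ hc (h i)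
  refine (sum_le_card_nsmul _ _ _ this).trans (le_of_eq ?_)
  simp

theorem le_invEsymm_of_le (hk : k ≤ Fintype.card ι) (hl : ∀ i, 0 < l i) {c : ℝ}
    (h : ∀ i, l i ≤ c) : (c⁻¹) ^ k ≤ invEsymm k l := by
  obtain ⟨S, hS⟩ : (powersetCard k (univ : Finset ι)).Nonempty :=
    powersetCard_nonempty.2 (by simpa using hk)
  unfold invEsymm
  refine le_trans ?_ (single_le_sum (f := fun S => ∏ i ∈ S, (l i)⁻¹)
    (fun T _ => prod_nonneg fun i _ => (inv_pos.2 (hl i)).le) hS)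
  rw [← (mem_powersetCard.1 hS).2, ← prod_const]
  refine prod_le_prod (fun i _ => ?_) fun i _ => inv_anti₀ (hl i) (h i)
  exact (inv_pos.2 ((hl i).trans_le (h i))).le

/-- A single product over a `k`-set containing `i` already bounds the sum from below, and its other
`k - 1` factors are at least `c⁻¹`. This turns an upper bound on all eigenvalues into a lower bound
on each. -/
theorem le_mul_invEsymm (hk1 : 1 ≤ k) (hk : k ≤ Fintype.card ι) (hl : ∀ i, 0 < l i) {c : ℝ}
    (h : ∀ i, l i ≤ c) (i : ι) : (l i)⁻¹ ≤ invEsymm k l * c ^ (k - 1) := by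
  have hc : 0 < c := (hl i).trans_le (h i)
  obtain ⟨S, hiS, hS⟩ : ∃ S : Finset ι, {i} ⊆ S ∧ S.card = k :=
    exists_superset_card_eq (by simpa using hk1) hk
  have hS' : S ∈ powersetCard k (univ : Finset ι) := mem_powersetCard.2 ⟨subset_univ _, hS⟩
  have hi : i ∈ S := hiS (mem_singleton_self i)
  have h1 := single_le_sum (f := fun S => ∏ i ∈ S, (l i)⁻¹)
    (fun T _ => prod_nonneg fun i _ => (inv_pos.2 (hl i)).le) hS'
  have h2 : (c⁻¹) ^ (k - 1) ≤ ∏ j ∈ S.erase i, (l j)⁻¹ := by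
    rw [← hS, ← card_erase_of_mem hi, ← prod_const]
    exact prod_le_prod (fun _ _ => (inv_pos.2 hc).le) fun j _ => inv_anti₀ (hl j) (h j)
  have h3 : (l i)⁻¹ * (c⁻¹) ^ (k - 1) ≤ invEsymm k l := by
    refine le_trans ?_ h1
    rw [← mul_prod_erase S _ hi]
    exact mul_le_mul_of_nonneg_left h2 (inv_pos.2 (hl i)).le
  calc (l i)⁻¹ = (l i)⁻¹ * (c⁻¹) ^ (k - 1) * c ^ (k - 1) := by
        rw [mul_assoc, ← mul_pow, inv_mul_cancel₀ hc.ne', one_pow, mul_one]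
    _ ≤ _ := mul_le_mul_of_nonneg_right h3 (pow_nonneg hc.le _)

/-- Some product over a `k`-set `S` is at least average, so one of its factors is not small. The
logarithmic derivative of that single term already contributes enough to the sum. -/
theorem le_sum_invWeight (hk1 : 1 ≤ k) (hk : k ≤ Fintype.card ι) (hl : ∀ i, 0 < l i) {q : ℝ}
    (hq : 0 < q) (hql : q ≤ invEsymm k l) :
    min 1 (q / (Fintype.card ι).choose k) / (Fintype.card ι).choose k ≤
      ∑ i, invWeight k l i := by
  set N : ℝ := ((Fintype.card ι).choose k : ℝ) with hN
  have hNpos : 0 < N := by rw [hN]; exact_mod_cast Nat.choose_pos hk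
  have hQ := invEsymm_pos hk hl
  have hprod : ∀ S : Finset ι, 0 < ∏ i ∈ S, (l i)⁻¹ := fun S =>
    prod_pos fun i _ => inv_pos.2 (hl i)
  obtain ⟨S, hS, hSq⟩ : ∃ S ∈ powersetCard k (univ : Finset ι),
      invEsymm k l / N ≤ ∏ i ∈ S, (l i)⁻¹ := by
    refine exists_le_of_sum_le (powersetCard_nonempty.2 (by simpa using hk)) ?_
    rw [sum_const, card_powersetCard, card_univ, nsmul_eq_mul, ← hN, mul_div_cancel₀ _ hNpos.ne']
    exact le_rfl
  -- The cap at `1` gives `δ ^ k ≤ δ`, which avoids a `k`-th root: if all factors over `S` were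
  -- below `δ`, their product would be below `q / N`.
  set δ : ℝ := min 1 (q / N) with hδ
  have hδ0 : 0 < δ := lt_min one_pos (div_pos hq hNpos)
  obtain ⟨i, hi, hδi⟩ : ∃ i ∈ S, δ ≤ (l i)⁻¹ := by
    by_contra! hcon
    have hSne : S.Nonempty := card_pos.1 (by rw [(mem_powersetCard.1 hS).2]; omega)
    have h1 : ∏ i ∈ S, (l i)⁻¹ < ∏ _i ∈ S, δ :=
      prod_lt_prod_of_nonempty (fun i _ => inv_pos.2 (hl i)) hcon hSne
    rw [prod_const, (mem_powersetCard.1 hS).2] at h1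
    have h2 : δ ^ k ≤ δ := pow_le_of_le_one hδ0.le (min_le_left _ _) (by omega)
    have h3 : δ ≤ q / N := min_le_right _ _
    have h4 : q / N ≤ invEsymm k l / N := by gcongr
    linarith
  have h5 := sum_invWeight_mul (k := k) (l := l) (fun _ => 1)
  simp only [mul_one] at h5
  rw [h5, le_div_iff₀ hQ]
  calc δ / N * invEsymm k l = invEsymm k l / N * δ := by ring
    _ ≤ (∏ j ∈ S, (l j)⁻¹) * ∑ i ∈ S, (l i)⁻¹ := by
        refine mul_le_mul hSq (hδi.trans ?_) hδ0.le (hprod S).le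
        exact single_le_sum (f := fun i => (l i)⁻¹) (fun j _ => (inv_pos.2 (hl j)).le) hi
    _ ≤ _ := single_le_sum (f := fun S => (∏ j ∈ S, (l j)⁻¹) * ∑ i ∈ S, (l i)⁻¹)
        (fun T _ => mul_nonneg (hprod T).le (sum_nonneg fun j _ => (inv_pos.2 (hl j)).le)) hS

end InvEsymm

/-! ### The quotient of elementary symmetric functions on symmetric operators. -/

section Quotient

variable {V : Type*} [NormedAddCommGroup V] [InnerProductSpace ℝ V] [FiniteDimensional ℝ V]
  {n k : ℕ} {T : V →ₗ[ℝ] V}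

theorem sigma_eq_sum_eigenvalues (hT : T.IsSymmetric) (hn : Module.finrank ℝ V = n) (j : ℕ) :
    sigma j T = ∑ S ∈ Finset.powersetCard j (Finset.univ : Finset (Fin n)),
      ∏ i ∈ S, hT.eigenvalues hn i := by
  rw [sigma, hT.roots_charpoly_eq_eigenvalues hn]
  exact Finset.esymm_map_val _ _ _

theorem sigma_div_sigma (hT : T.IsSymmetric) (hn : Module.finrank ℝ V = n) (hk : k ≤ n)
    (hpos : ∀ i, 0 < hT.eigenvalues hn i) :
    sigma n T / sigma (n - k) T = (invEsymm k (hT.eigenvalues hn))⁻¹ := by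
  set l := hT.eigenvalues hn
  have hq : 0 < invEsymm k l := invEsymm_pos (by simpa using hk) hpos
  have h1 : sigma n T = ∏ i, l i := by
    rw [sigma_eq_sum_eigenvalues hT hn]
    have : Finset.powersetCard n (Finset.univ : Finset (Fin n)) = {Finset.univ} :=
      (congrArg (Finset.powersetCard · _) (Finset.card_fin n).symm).trans
        (Finset.powersetCard_self _)
    rw [this, Finset.sum_singleton]
  -- Complementation matches `(n - k)`-sets with `k`-sets; a product over `S` is the full product
  -- times the reciprocals over `Sᶜ`.
  have h2 : sigma (n - k) T = (∏ i, l i) * invEsymm k l := by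
    rw [sigma_eq_sum_eigenvalues hT hn, invEsymm, Finset.mul_sum]
    refine Finset.sum_bij (fun S _ => Sᶜ) ?_ ?_ ?_ ?_
    · intro S hS
      have := (Finset.mem_powersetCard.1 hS).2
      refine Finset.mem_powersetCard.2 ⟨Finset.subset_univ _, ?_⟩
      rw [Finset.card_compl, this, Fintype.card_fin]; omega
    · intro S _ S' _ h; exact compl_injective h
    · intro S hS
      have := (Finset.mem_powersetCard.1 hS).2
      refine ⟨Sᶜ, Finset.mem_powersetCard.2 ⟨Finset.subset_univ _, ?_⟩, compl_compl S⟩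
      rw [Finset.card_compl, this, Fintype.card_fin]
    · intro S _
      rw [← Finset.prod_mul_prod_compl S l, mul_assoc, ← Finset.prod_mul_distrib,
        Finset.prod_congr rfl fun i _ => mul_inv_cancel₀ (hpos i).ne']
      simp [l]
  have hp : 0 < ∏ i, l i := Finset.prod_pos fun i _ => hpos i
  rw [h1, h2]
  field_simp

/-- Concavity of `log (σ_n / σ_{n-k})` on positive symmetric operators, in the form of a tangent
plane inequality at a diagonal operator. -/
theorem log_sigma_div_sigma_le (hT : T.IsSymmetric) (hn : Module.finrank ℝ V = n) (hk : k ≤ n)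
    (hpos : ∀ u, u ≠ 0 → 0 < inner ℝ (T u) u) (e : OrthonormalBasis (Fin n) ℝ V)
    {l : Fin n → ℝ} (hl : ∀ i, 0 < l i) :
    Real.log (sigma n T / sigma (n - k) T) ≤
      -Real.log (invEsymm k l) + ∑ i, invWeight k l i * (inner ℝ (T (e i)) (e i) - l i) := by
  set b := hT.eigenvectorBasis hn
  set μ := hT.eigenvalues hn
  have hTb : ∀ i, T (b i) = μ i • b i := fun i => hT.apply_eigenvectorBasis hn i
  have hμ : ∀ i, 0 < μ i := by
    intro i
    have := hpos (b i) (b.orthonormal.ne_zero i)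
    rw [hTb, real_inner_smul_left, real_inner_self_eq_norm_sq, b.orthonormal.norm_eq_one] at this
    simpa using this
  rw [sigma_div_sigma hT hn hk hμ, Real.log_inv]
  -- Schur's observation: the diagonal of `T` in the basis `e` is the image of its eigenvalues under
  -- the doubly stochastic matrix of squared cosines between the two orthonormal bases.
  let P : Matrix (Fin n) (Fin n) ℝ := Matrix.of fun i j => inner ℝ (b j) (e i) ^ 2
  have hP : P ∈ doublyStochastic ℝ (Fin n) := by
    rw [mem_doublyStochastic_iff_sum]
    refine ⟨fun i j => sq_nonneg _, fun i => ?_, fun j => ?_⟩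
    · have := b.sum_sq_norm_inner_right (e i)
      simpa [P, e.orthonormal.norm_eq_one] using this
    · have := e.sum_sq_norm_inner_left (b j)
      simpa [P, b.orthonormal.norm_eq_one] using this
  have hPm : ∀ i, P.mulVec μ i = inner ℝ (T (e i)) (e i) := by
    intro i
    rw [← b.sum_inner_mul_inner (T (e i)) (e i)]
    change ∑ j, P i j * μ j = _
    refine Finset.sum_congr rfl fun j _ => ?_
    rw [hT (e i) (b j), hTb, real_inner_smul_right, real_inner_comm (b j) (e i)]
    simp [P]; ring
  simp_rw [← hPm]
  exact neg_log_invEsymm_le_of_doublyStochastic (by simpa using hk) hl hμ hP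

end Quotient

/-! ### Directional derivatives and homogeneity. -/

section DirDeriv

variable {E : Type*} [NormedAddCommGroup E] [NormedSpace ℝ E]

/-- The derivative of `g` in the direction `v`. -/
noncomputable def dd (v : E) (g : E → ℝ) (y : E) : ℝ := fderiv ℝ g y v

variable {g : E → ℝ} {U : Set E} {x y : E}

theorem dd_add_left (v w : E) : dd (v + w) g y = dd v g y + dd w g y := map_add _ _ _

theorem dd_smul_left (c : ℝ) (v : E) : dd (c • v) g y = c * dd v g y := by simp [dd]

theorem dd_zero_left : dd (0 : E) g y = 0 := map_zero _

theorem dd_sum_left {ι : Type*} (s : Finset ι) (c : ι → ℝ) (v : ι → E) :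
    dd (∑ i ∈ s, c i • v i) g y = ∑ i ∈ s, c i * dd (v i) g y := by
  simp [dd, map_sum]

theorem dd_congr_of_eqOn {g' : E → ℝ} (hU : IsOpen U) (h : Set.EqOn g g' U) (v : E) :
    Set.EqOn (dd v g) (dd v g') U := fun y hy => by
  rw [dd, dd, (h.eventuallyEq_of_mem (hU.mem_nhds hy)).fderiv_eq]

theorem ContDiffOn.dd {m : ℕ} (hg : ContDiffOn ℝ (m + 1 : ℕ) g U) (hU : IsOpen U) (v : E) :
    ContDiffOn ℝ m (dd v g) U :=
  (hg.fderiv_of_isOpen hU (m := m) (by norm_cast)).clm_apply contDiffOn_const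

theorem dd_dd_eq_fderiv {E : Type*} [NormedAddCommGroup E] [NormedSpace ℝ E] {g : E → ℝ}
    {U : Set E} (hg : ContDiffOn ℝ 2 g U) (hU : IsOpen U) {y : E} (hy : y ∈ U) (a b : E) :
    dd a (dd b g) y = fderiv ℝ (fderiv ℝ g) y a b := by
  have h2 : DifferentiableAt ℝ (fderiv ℝ g) y :=
    ((hg.contDiffAt (hU.mem_nhds hy)).fderiv_right (m := 1) (by norm_num)).differentiableAt
      (by norm_num)
  have : fderiv ℝ (fun z => fderiv ℝ g z b) y = (fderiv ℝ (fderiv ℝ g) y).flip b := by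
    rw [fderiv_clm_apply h2 (differentiableAt_const b)]; simp
  change fderiv ℝ (fun z => fderiv ℝ g z b) y a = _
  rw [this]; rfl

theorem dd_comm (hg : ContDiffOn ℝ 2 g U) (hU : IsOpen U) (v w : E) :
    Set.EqOn (dd v (dd w g)) (dd w (dd v g)) U := by
  intro y hy
  have h : IsSymmSndFDerivAt ℝ g y := (hg.contDiffAt (hU.mem_nhds hy)).isSymmSndFDerivAt (by simp)
  rw [dd_dd_eq_fderiv hg hU hy, dd_dd_eq_fderiv hg hU hy, h v w]

theorem hasDerivAt_line {v : E} {t : ℝ} (hg : DifferentiableAt ℝ g (x + t • v)) :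
    HasDerivAt (fun t : ℝ => g (x + t • v)) (dd v g (x + t • v)) t := by
  have h1 : HasDerivAt (fun t : ℝ => x + t • v) v t := by
    simpa using ((hasDerivAt_id t).smul_const v).const_add x
  exact hg.hasFDerivAt.comp_hasDerivAt t h1

theorem hasDerivAt_dd_curve {c : ℝ → E} {c' : E} {t : ℝ} (hc : HasDerivAt c c' t)
    (hg : DifferentiableAt ℝ g (c t)) : HasDerivAt (fun t => g (c t)) (dd c' g (c t)) t :=
  hg.hasFDerivAt.comp_hasDerivAt t hc

/-- `g` is positively homogeneous of degree `d` away from the origin. -/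
def PosHomog (d : ℤ) (g : E → ℝ) : Prop :=
  ∀ c : ℝ, 0 < c → ∀ y : E, y ≠ 0 → g (c • y) = c ^ d * g y

theorem PosHomog.dd {d : ℤ} (h : PosHomog d g) (v : E) : PosHomog (d - 1) (dd v g) := by
  intro c hc y hy
  have h1 : fderiv ℝ (fun z => g (c • z)) y = fderiv ℝ (fun z => c ^ d * g z) y := by
    refine Filter.EventuallyEq.fderiv_eq ?_
    filter_upwards [isOpen_compl_singleton.mem_nhds hy] with z hz using h c hc z hz
  rw [fderiv_comp_smul] at h1
  have h2 := congrArg (fun L => L v) h1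
  have h3 : fderiv ℝ (fun z => c ^ d * g z) y = c ^ d • fderiv ℝ g y :=
    congrFun (fderiv_const_smul_field (𝕜 := ℝ) (f := g) (c ^ d)) y
  rw [h3] at h2
  simp only [smul_apply, smul_eq_mul] at h2
  change fderiv ℝ g (c • y) v = c ^ (d - 1) * fderiv ℝ g y v
  rw [zpow_sub_one₀ hc.ne']
  field_simp
  linarith

theorem PosHomog.dd_self {d : ℤ} (h : PosHomog d g) (hy : y ≠ 0)
    (hg : DifferentiableAt ℝ g y) : _root_.dd y g y = d * g y := by
  -- Euler's relation, by differentiating `g (c • y) = c ^ d * g y` at `c = 1`.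
  have h1 : HasDerivAt (fun c : ℝ => g (c • y)) (_root_.dd y g ((1 : ℝ) • y)) 1 := by
    refine hasDerivAt_dd_curve (by simpa using (hasDerivAt_id (1 : ℝ)).smul_const y) ?_
    rwa [one_smul]
  have h2 : HasDerivAt (fun c : ℝ => c ^ d * g y) (d * g y) 1 := by
    simpa using (hasDerivAt_zpow d (1 : ℝ) (by simp)).mul_const (g y)
  have h3 : (fun c : ℝ => g (c • y)) =ᶠ[𝓝 1] fun c => c ^ d * g y := by
    filter_upwards [lt_mem_nhds one_pos] with c hc using h c hc y hy
  rw [one_smul] at h1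
  exact h1.unique (h2.congr_of_eventuallyEq h3)

end DirDeriv

/-! ### Two-jets of functions of one variable. -/

section Jet

/-- `φ` is twice differentiable at `0`, with value `a` and derivatives `b` and `c` there. -/
def HasJet (φ : ℝ → ℝ) (a b c : ℝ) : Prop :=
  φ 0 = a ∧ ∃ φ' : ℝ → ℝ, (∀ᶠ t in 𝓝 0, HasDerivAt φ (φ' t) t) ∧ φ' 0 = b ∧ HasDerivAt φ' c 0

variable {φ ψ : ℝ → ℝ} {a b c a' b' c' : ℝ}

theorem HasJet.hasDerivAt (h : HasJet φ a b c) : HasDerivAt φ b 0 := by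
  obtain ⟨-, φ', h1, rfl, -⟩ := h
  exact h1.self_of_nhds

theorem HasJet.add (h : HasJet φ a b c) (h' : HasJet ψ a' b' c') :
    HasJet (fun t => φ t + ψ t) (a + a') (b + b') (c + c') := by
  obtain ⟨rfl, φ', h1, rfl, h2⟩ := h
  obtain ⟨rfl, ψ', h1', rfl, h2'⟩ := h'
  refine ⟨rfl, fun t => φ' t + ψ' t, ?_, rfl, h2.add h2'⟩
  filter_upwards [h1, h1'] with t ht ht' using ht.add ht'

theorem HasJet.mul (h : HasJet φ a b c) (h' : HasJet ψ a' b' c') :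
    HasJet (fun t => φ t * ψ t) (a * a') (b * a' + a * b') (c * a' + 2 * (b * b') + a * c') := by
  have hb := h.hasDerivAt
  have hb' := h'.hasDerivAt
  obtain ⟨rfl, φ', h1, rfl, h2⟩ := h
  obtain ⟨rfl, ψ', h1', rfl, h2'⟩ := h'
  refine ⟨rfl, fun t => φ' t * ψ t + φ t * ψ' t, ?_, rfl, ?_⟩
  · filter_upwards [h1, h1'] with t ht ht' using ht.mul ht'
  · exact ((h2.mul hb').add (hb.mul h2')).congr_deriv (by ring)

theorem hasJet_const (a : ℝ) : HasJet (fun _ => a) a 0 0 :=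
  ⟨rfl, fun _ => 0, Filter.Eventually.of_forall fun t => hasDerivAt_const t a, rfl,
    hasDerivAt_const _ _⟩

theorem HasJet.const_mul (h : HasJet φ a b c) (r : ℝ) :
    HasJet (fun t => r * φ t) (r * a) (r * b) (r * c) := by
  simpa using (hasJet_const r).mul h

theorem HasJet.sum {ι : Type*} (s : Finset ι) {φ : ι → ℝ → ℝ} {a b c : ι → ℝ}
    (h : ∀ i ∈ s, HasJet (φ i) (a i) (b i) (c i)) :
    HasJet (fun t => ∑ i ∈ s, φ i t) (∑ i ∈ s, a i) (∑ i ∈ s, b i) (∑ i ∈ s, c i) := by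
  classical
  induction s using Finset.induction_on with
  | empty => simpa using hasJet_const 0
  | insert i s hi ih =>
    simp only [Finset.sum_insert hi]
    exact (h i (Finset.mem_insert_self i s)).add
      (ih fun j hj => h j (Finset.mem_insert_of_mem hj))

theorem HasJet.log (h : HasJet φ a b c) (ha : a ≠ 0) :
    HasJet (fun t => Real.log (φ t)) (Real.log a) (b / a) (c / a - (b / a) ^ 2) := by
  have hb := h.hasDerivAt
  obtain ⟨rfl, φ', h1, rfl, h2⟩ := h
  refine ⟨rfl, fun t => φ' t / φ t, ?_, rfl, ?_⟩
  · filter_upwards [h1, hb.continuousAt.eventually_ne ha] with t ht ht' using ht.log ht'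
  · exact (h2.div hb ha).congr_deriv (by field_simp)

theorem hasJet_sqrt_one_add_sq : HasJet (fun t => √(1 + t ^ 2)) 1 0 1 := by
  have h : ∀ t : ℝ, HasDerivAt (fun t => √(1 + t ^ 2)) (t / √(1 + t ^ 2)) t := by
    intro t
    have h1 : HasDerivAt (fun t : ℝ => 1 + t ^ 2) (2 * t) t := by
      simpa using (hasDerivAt_pow 2 t).const_add 1
    exact (h1.sqrt (by positivity)).congr_deriv (by field_simp)
  refine ⟨by simp, fun t => t / √(1 + t ^ 2), Filter.Eventually.of_forall h, by simp, ?_⟩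
  exact ((hasDerivAt_id (0 : ℝ)).div (h 0) (by simp)).congr_deriv (by simp)

/-- The second derivative test in necessary form. If `c` were positive, `0` would also be a local
minimum, so `φ` would be locally constant and `c` would vanish. -/
theorem HasJet.of_isLocalMax (h : HasJet φ a b c) (hm : IsLocalMax φ 0) : b = 0 ∧ c ≤ 0 := by
  have hb := h.hasDerivAt
  have hb0 : b = 0 := hm.hasDerivAt_eq_zero hb
  refine ⟨hb0, ?_⟩
  obtain ⟨-, φ', h1, hφ', h2⟩ := h
  by_contra! hc
  have hd : deriv φ =ᶠ[𝓝 0] φ' := by filter_upwards [h1] with t ht using ht.deriv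
  have h3 : deriv (deriv φ) 0 = c := by rw [hd.deriv_eq, h2.deriv]
  have h4 : IsLocalMin φ 0 := isLocalMin_of_deriv_deriv_pos (by rw [h3]; exact hc)
    (by rw [hb.deriv, hb0]) hb.continuousAt
  have h5 : φ =ᶠ[𝓝 0] fun _ => φ 0 := by
    filter_upwards [hm, h4] with t ht ht' using le_antisymm ht ht'
  have h6 : deriv φ =ᶠ[𝓝 0] fun _ => 0 := by
    filter_upwards [h5.eventuallyEq_nhds] with t ht
    rw [ht.deriv_eq]; simp
  have h7 : deriv (deriv φ) 0 = 0 := by rw [h6.deriv_eq]; simp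
  linarith

theorem hasJet_line {E : Type*} [NormedAddCommGroup E] [NormedSpace ℝ E] {g : E → ℝ} {U : Set E}
    {x : E} (hU : IsOpen U) (hg : ContDiffOn ℝ 2 g U) (hx : x ∈ U) (v : E) :
    HasJet (fun t => g (x + t • v)) (g x) (dd v g x) (dd v (dd v g) x) := by
  have hc : Continuous fun t : ℝ => x + t • v := by fun_prop
  have h0 : x + (0 : ℝ) • v = x := by simp
  refine ⟨by simp, fun t => dd v g (x + t • v), ?_, by simp, ?_⟩
  · have : ∀ᶠ t in 𝓝 (0 : ℝ), x + t • v ∈ U :=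
      hc.continuousAt.eventually_mem (by rw [h0]; exact hU.mem_nhds hx)
    filter_upwards [this] with t ht
    exact hasDerivAt_line ((hg.differentiableOn (by norm_num)).differentiableAt (hU.mem_nhds ht))
  · have h1 : ContDiffOn ℝ (1 : ℕ) (dd v g) U := ContDiffOn.dd (m := 1) (by exact_mod_cast hg) hU v
    have h2 := (h1.differentiableOn (by norm_num)).differentiableAt (hU.mem_nhds hx)
    have := hasDerivAt_line (x := x) (v := v) (t := 0) (g := dd v g) (by rwa [h0])
    rwa [h0] at this

end Jet

/-! ### Product rule and derivatives of the norm. -/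

section DirDeriv

variable {E : Type*} [NormedAddCommGroup E]

theorem dd_mul [NormedSpace ℝ E] {f g : E → ℝ} {y : E} (hf : DifferentiableAt ℝ f y)
    (hg : DifferentiableAt ℝ g y) (v : E) :
    dd v (fun z => f z * g z) y = dd v f y * g y + f y * dd v g y := by
  unfold dd
  rw [fderiv_fun_mul hf hg]
  simp; ring

theorem dd_add_right [NormedSpace ℝ E] {f g : E → ℝ} {y : E} (hf : DifferentiableAt ℝ f y)
    (hg : DifferentiableAt ℝ g y) (v : E) :
    dd v (fun z => f z + g z) y = dd v f y + dd v g y := by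
  unfold dd
  rw [fderiv_fun_add hf hg]
  simp

theorem dd_norm [InnerProductSpace ℝ E] {y : E} (hy : y ≠ 0) (v : E) :
    dd v (fun z => ‖z‖) y = inner ℝ y v / ‖y‖ := by
  have hn : DifferentiableAt ℝ (fun z : E => ‖z‖) y := differentiableAt_fun_id.norm ℝ hy
  have h1 := dd_mul hn hn v
  have h2 : dd v (fun z : E => ‖z‖ * ‖z‖) y = 2 * inner ℝ y v := by
    simp_rw [← sq]
    simp [dd, fderiv_norm_sq_apply]
  have h3 : ‖y‖ ≠ 0 := norm_ne_zero_iff.2 hy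
  rw [h2] at h1
  field_simp
  linarith

theorem differentiableAt_dd_norm [InnerProductSpace ℝ E] {y : E} (hy : y ≠ 0) (v : E) :
    DifferentiableAt ℝ (dd v fun z => ‖z‖) y := by
  have h1 : DifferentiableAt ℝ (fun z : E => inner ℝ z v * ‖z‖⁻¹) y :=
    (differentiableAt_fun_id.inner ℝ (differentiableAt_const v)).fun_mul
      ((differentiableAt_fun_id.norm ℝ hy).fun_inv (norm_ne_zero_iff.2 hy))
  refine h1.congr_of_eventuallyEq ?_
  filter_upwards [isOpen_compl_singleton.mem_nhds hy] with z hz using (dd_norm hz v).trans (div_eq_mul_inv _ _)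

theorem dd_dd_norm [InnerProductSpace ℝ E] {x u w : E} (hx : ‖x‖ = 1) (hu : inner ℝ x u = 0) :
    dd u (dd w fun z => ‖z‖) x = inner ℝ u w := by
  have hx0 : x ≠ 0 := by rintro rfl; simp at hx
  have hn : DifferentiableAt ℝ (fun z : E => ‖z‖) x := differentiableAt_fun_id.norm ℝ hx0
  -- Differentiating the identity `∂_w‖z‖ · ‖z‖ = ⟨z, w⟩` once more avoids differentiating a
  -- quotient.
  have h1 : Set.EqOn (fun z => dd w (fun z => ‖z‖) z * ‖z‖) (fun z => inner ℝ z w) {0}ᶜ := by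
    intro z hz
    simp only
    rw [dd_norm hz, div_mul_cancel₀ _ (norm_ne_zero_iff.2 hz)]
  have h2 := dd_congr_of_eqOn isOpen_compl_singleton h1 u hx0
  rw [dd_mul (differentiableAt_dd_norm hx0 w) hn, dd_norm hx0 u, hu, hx] at h2
  have h3 : dd u (fun z => inner ℝ z w) x = inner ℝ u w := by
    simp [dd, fderiv_inner_apply ℝ differentiableAt_fun_id (differentiableAt_const w)]
  rw [h3] at h2
  simpa using h2

end DirDeriv

/-! ### Homogeneous extensions and `τ[s]` as an ambient Hessian. -/

section Extension

variable {n : ℕ} {s : Sph n → ℝ}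

theorem Sph.ne_zero (x : Sph n) : (x : Amb n) ≠ 0 := ne_zero_of_mem_unit_sphere x

theorem Sph.norm_eq (x : Sph n) : ‖(x : Amb n)‖ = 1 := norm_eq_of_mem_sphere x

/-- The point `y / ‖y‖` of the sphere. -/
noncomputable def toSph (y : Amb n) (hy : y ≠ 0) : Sph n :=
  ⟨‖y‖⁻¹ • y, by simp [norm_smul, inv_mul_cancel₀ (norm_ne_zero_iff.mpr hy)]⟩

theorem radialExt_of_ne (s : Sph n → ℝ) {y : Amb n} (hy : y ≠ 0) :
    radialExt s y = s (toSph y hy) := by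
  rw [radialExt, dif_pos hy]; rfl

theorem toSph_coe (x : Sph n) : toSph (x : Amb n) x.ne_zero = x := by
  apply Subtype.ext; simp [toSph, x.norm_eq]

theorem radialExt_coe (s : Sph n → ℝ) (x : Sph n) : radialExt s (x : Amb n) = s x := by
  rw [radialExt_of_ne s x.ne_zero, toSph_coe]

theorem posHomog_radialExt (s : Sph n → ℝ) : PosHomog 0 (radialExt s) := by
  intro c hc y hy
  have hcy : c • y ≠ 0 := smul_ne_zero hc.ne' hy
  rw [radialExt_of_ne s hcy, radialExt_of_ne s hy, zpow_zero, one_mul]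
  congr 1
  apply Subtype.ext
  simp only [toSph, norm_smul, Real.norm_of_nonneg hc.le, smul_smul, mul_inv]
  congr 1
  field_simp

theorem contDiffOn_radialExt {m : ℕ∞ω} (hs : ContMDiff (𝓡 n) 𝓘(ℝ, ℝ) m s) :
    ContDiffOn ℝ m (radialExt s) {0}ᶜ := by
  let V : TopologicalSpace.Opens (Amb n) := ⟨{0}ᶜ, isOpen_compl_singleton⟩
  have h1 : ContMDiff 𝓘(ℝ, Amb n) 𝓘(ℝ, Amb n) m fun y : V => ‖(y : Amb n)‖⁻¹ • (y : Amb n) := by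
    intro y
    have hy : (y : Amb n) ≠ 0 := y.2
    refine (contMDiffAt_subtype_iff (f := fun y : Amb n => ‖y‖⁻¹ • y)).2 ?_
    exact (((contDiffAt_norm ℝ hy).inv (norm_ne_zero_iff.2 hy)).smul contDiffAt_id).contMDiffAt
  have h2 : ContMDiff 𝓘(ℝ, Amb n) (𝓡 n) m fun y : V => toSph (y : Amb n) y.2 :=
    haveI : Fact (Module.finrank ℝ (Amb n) = n + 1) := ⟨finrank_euclideanSpace_fin⟩
    h1.codRestrict_sphere _
  have h3 : ContMDiff 𝓘(ℝ, Amb n) 𝓘(ℝ, ℝ) m fun y : V => radialExt s (y : Amb n) := by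
    have : (fun y : V => radialExt s (y : Amb n)) = fun y : V => s (toSph (y : Amb n) y.2) :=
      funext fun y => radialExt_of_ne s y.2
    rw [this]
    exact hs.comp h2
  intro y hy
  have h4 := (contMDiffAt_subtype_iff (U := V) (x := ⟨y, hy⟩)).1 (h3 ⟨y, hy⟩)
  exact h4.contDiffAt.contDiffWithinAt

theorem inner_sphereGrad (s : Sph n → ℝ) (y v : Amb n) :
    inner ℝ (sphereGrad s y) v = dd v (radialExt s) y := by
  rw [sphereGrad, gradient, InnerProductSpace.toDual_symm_apply, dd]

theorem contDiffOn_sphereGrad (hr : ContDiffOn ℝ 2 (radialExt s) {0}ᶜ) :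
    ContDiffOn ℝ 1 (sphereGrad s) {0}ᶜ := by
  have h := hr.fderiv_of_isOpen isOpen_compl_singleton (m := 1) (by norm_num)
  exact (InnerProductSpace.toDual ℝ (Amb n)).symm.contDiff.comp_contDiffOn h

theorem inner_fderiv_sphereGrad (hr : ContDiffOn ℝ 2 (radialExt s) {0}ᶜ) {y : Amb n}
    (hy : y ≠ 0) (u v : Amb n) :
    inner ℝ (fderiv ℝ (sphereGrad s) y u) v = dd u (dd v (radialExt s)) y := by
  have h1 : DifferentiableAt ℝ (sphereGrad s) y :=
    ((contDiffOn_sphereGrad hr).differentiableOn (by norm_num)).differentiableAt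
      (isOpen_compl_singleton.mem_nhds hy)
  have h2 : dd v (radialExt s) = fun z => inner ℝ (sphereGrad s z) v :=
    funext fun z => (inner_sphereGrad s z v).symm
  rw [h2, dd, fderiv_inner_apply ℝ h1 (differentiableAt_const v)]
  simp

/-- The one-homogeneous extension of a function on the sphere. -/
noncomputable def homExt (s : Sph n → ℝ) (y : Amb n) : ℝ := ‖y‖ * radialExt s y

theorem homExt_coe (s : Sph n → ℝ) (x : Sph n) : homExt s (x : Amb n) = s x := by
  simp [homExt, x.norm_eq, radialExt_coe]

theorem posHomog_homExt (s : Sph n → ℝ) : PosHomog 1 (homExt s) := by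
  intro c hc y hy
  rw [homExt, posHomog_radialExt s c hc y hy, homExt, norm_smul, Real.norm_of_nonneg hc.le]
  simp; ring

theorem contDiffOn_homExt {m : ℕ∞ω} (hs : ContMDiff (𝓡 n) 𝓘(ℝ, ℝ) m s) :
    ContDiffOn ℝ m (homExt s) {0}ᶜ :=
  ContDiffOn.mul (fun _ hy => (contDiffAt_norm ℝ hy).contDiffWithinAt) (contDiffOn_radialExt hs)

theorem inner_sphereHess (f : Sph n → ℝ) (x : Sph n) (u w : TanSp x) :
    inner ℝ (sphereHess f x u) w =
      inner ℝ (fderiv ℝ (sphereGrad f) (x : Amb n) (u : Amb n)) (w : Amb n) := by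
  simp only [sphereHess, ContinuousLinearMap.comp_apply, Submodule.subtypeL_apply]
  rw [Submodule.inner_orthogonalProjectionOnto_eq_of_mem_right]

/-- In the Hessian of `‖y‖ · radialExt s` the mixed terms vanish, since the norm has no first
derivative in tangent directions. The Hessian of the norm is the metric there and yields the term `s
g`. -/
theorem inner_tau (hs : ContMDiff (𝓡 n) 𝓘(ℝ, ℝ) 2 s) (x : Sph n) (u w : TanSp x) :
    inner ℝ (tau s x u) w = dd (u : Amb n) (dd (w : Amb n) (homExt s)) x := by
  have hr := contDiffOn_radialExt hs
  have hx0 := x.ne_zero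
  have hx := x.norm_eq
  have hu : inner ℝ (x : Amb n) (u : Amb n) = 0 :=
    Submodule.mem_orthogonal_singleton_iff_inner_right.1 u.2
  have hw : inner ℝ (x : Amb n) (w : Amb n) = 0 :=
    Submodule.mem_orthogonal_singleton_iff_inner_right.1 w.2
  have hU : IsOpen ({0}ᶜ : Set (Amb n)) := isOpen_compl_singleton
  have hn : ∀ z : Amb n, z ≠ 0 → DifferentiableAt ℝ (fun z : Amb n => ‖z‖) z := fun z hz =>
    differentiableAt_fun_id.norm ℝ hz
  have hrd : ∀ z : Amb n, z ≠ 0 → DifferentiableAt ℝ (radialExt s) z := fun z hz =>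
    (hr.differentiableOn (by norm_num)).differentiableAt (hU.mem_nhds hz)
  have hrd' : DifferentiableAt ℝ (dd (w : Amb n) (radialExt s)) x :=
    ((ContDiffOn.dd (m := 1) (by exact_mod_cast hr) hU _).differentiableOn
      (by norm_num)).differentiableAt (hU.mem_nhds hx0)
  have h1 : Set.EqOn (dd (w : Amb n) (homExt s)) (fun z => dd (w : Amb n) (fun z => ‖z‖) z *
      radialExt s z + ‖z‖ * dd (w : Amb n) (radialExt s) z) {0}ᶜ := fun z hz =>
    dd_mul (hn z hz) (hrd z hz) _
  have h3 := dd_add_right ((differentiableAt_dd_norm hx0 (w : Amb n)).fun_mul (hrd _ hx0))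
    ((hn _ hx0).fun_mul hrd') (u : Amb n)
  rw [dd_congr_of_eqOn hU h1 _ hx0, h3,
    dd_mul (differentiableAt_dd_norm hx0 _) (hrd _ hx0), dd_mul (hn _ hx0) hrd',
    dd_dd_norm hx hu, dd_norm hx0, dd_norm hx0, hu, hw, hx, radialExt_coe,
    ← inner_fderiv_sphereGrad hr hx0]
  simp only [tau, add_apply, smul_apply, inner_add_left, inner_sphereHess]
  simp [real_inner_smul_left]; ring

end Extension

/-! ### Homogeneity identities, convexity along great circles, positivity. -/

section Support

variable {n : ℕ} {s : Sph n → ℝ}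

theorem isOpen_punctured : IsOpen ({0}ᶜ : Set (Amb n)) := isOpen_compl_singleton

theorem ContDiffOn.differentiableAt_punctured {m : ℕ∞ω} {g : Amb n → ℝ}
    (hg : ContDiffOn ℝ m g {0}ᶜ) (hm : m ≠ 0) {y : Amb n} (hy : y ≠ 0) :
    DifferentiableAt ℝ g y :=
  (hg.differentiableOn hm).differentiableAt (isOpen_punctured.mem_nhds hy)

theorem contDiffOn_dd_homExt (hs : ContMDiff (𝓡 n) 𝓘(ℝ, ℝ) 4 s) (v : Amb n) :
    ContDiffOn ℝ 3 (dd v (homExt s)) {0}ᶜ :=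
  ContDiffOn.dd (m := 3) (contDiffOn_homExt hs) isOpen_punctured v

theorem contDiffOn_dd_dd_homExt (hs : ContMDiff (𝓡 n) 𝓘(ℝ, ℝ) 4 s) (v w : Amb n) :
    ContDiffOn ℝ 2 (dd v (dd w (homExt s))) {0}ᶜ :=
  ContDiffOn.dd (m := 2) (contDiffOn_dd_homExt hs w) isOpen_punctured v

theorem contDiffOn_homExt_two (hs : ContMDiff (𝓡 n) 𝓘(ℝ, ℝ) 4 s) :
    ContDiffOn ℝ 2 (homExt s) {0}ᶜ :=
  (contDiffOn_homExt hs).of_le (by norm_num)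

theorem dd_dd_homExt_comm (hs : ContMDiff (𝓡 n) 𝓘(ℝ, ℝ) 4 s) (v w : Amb n) {y : Amb n}
    (hy : y ≠ 0) : dd v (dd w (homExt s)) y = dd w (dd v (homExt s)) y :=
  dd_comm (contDiffOn_homExt_two hs) isOpen_punctured v w hy

theorem dd_self_homExt (hs : ContMDiff (𝓡 n) 𝓘(ℝ, ℝ) 4 s) {y : Amb n} (hy : y ≠ 0) :
    dd y (homExt s) y = homExt s y := by
  simpa using (posHomog_homExt s).dd_self hy
    ((contDiffOn_homExt hs).differentiableAt_punctured (by norm_num) hy)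

theorem dd_self_dd_homExt (hs : ContMDiff (𝓡 n) 𝓘(ℝ, ℝ) 4 s) (v : Amb n) {y : Amb n}
    (hy : y ≠ 0) : dd y (dd v (homExt s)) y = 0 := by
  simpa using ((posHomog_homExt s).dd v).dd_self hy
    ((contDiffOn_dd_homExt hs v).differentiableAt_punctured (by norm_num) hy)

theorem dd_dd_self_homExt (hs : ContMDiff (𝓡 n) 𝓘(ℝ, ℝ) 4 s) (v : Amb n) {y : Amb n}
    (hy : y ≠ 0) : dd v (dd y (homExt s)) y = 0 := by
  rw [dd_dd_homExt_comm hs v y hy, dd_self_dd_homExt hs v hy]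

theorem dd_self_dd_dd_homExt (hs : ContMDiff (𝓡 n) 𝓘(ℝ, ℝ) 4 s) (v w : Amb n) {y : Amb n}
    (hy : y ≠ 0) : dd y (dd v (dd w (homExt s))) y = -dd v (dd w (homExt s)) y := by
  simpa using (((posHomog_homExt s).dd w).dd v).dd_self hy
    ((contDiffOn_dd_dd_homExt hs v w).differentiableAt_punctured (by norm_num) hy)

theorem dd_dd_homExt_add_right (hs : ContMDiff (𝓡 n) 𝓘(ℝ, ℝ) 4 s) (u v w : Amb n) {y : Amb n}
    (hy : y ≠ 0) : dd u (dd (v + w) (homExt s)) y =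
      dd u (dd v (homExt s)) y + dd u (dd w (homExt s)) y := by
  rw [dd_dd_homExt_comm hs _ _ hy, dd_add_left, dd_dd_homExt_comm hs v _ hy,
    dd_dd_homExt_comm hs w _ hy]

theorem dd_dd_homExt_smul_right (hs : ContMDiff (𝓡 n) 𝓘(ℝ, ℝ) 4 s) (c : ℝ) (u v : Amb n)
    {y : Amb n} (hy : y ≠ 0) : dd u (dd (c • v) (homExt s)) y = c * dd u (dd v (homExt s)) y := by
  rw [dd_dd_homExt_comm hs _ _ hy, dd_smul_left, dd_dd_homExt_comm hs v _ hy]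

/-- The Hessian of the homogeneous extension does not see the radial part of a vector. -/
theorem dd_dd_homExt_add_smul_self (hs : ContMDiff (𝓡 n) 𝓘(ℝ, ℝ) 4 s) (c : ℝ) (u : Amb n)
    {y : Amb n} (hy : y ≠ 0) : dd (u + c • y) (dd (u + c • y) (homExt s)) y =
      dd u (dd u (homExt s)) y := by
  rw [dd_add_left, dd_smul_left, dd_self_dd_homExt hs _ hy, dd_dd_homExt_add_right hs _ _ _ hy,
    dd_dd_homExt_smul_right hs _ _ _ hy, dd_dd_self_homExt hs _ hy]
  ring

theorem dd_dd_homExt_smul (c : ℝ) (hc : 0 < c) (u v : Amb n) {y : Amb n} (hy : y ≠ 0) :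
    dd u (dd v (homExt s)) (c • y) = c⁻¹ * dd u (dd v (homExt s)) y := by
  simpa using ((posHomog_homExt s).dd v).dd u c hc y hy

theorem mem_tanSp {x : Sph n} {u : Amb n} : u ∈ TanSp x ↔ inner ℝ (x : Amb n) u = 0 :=
  Submodule.mem_orthogonal_singleton_iff_inner_right

theorem finrank_tanSp (x : Sph n) : Module.finrank ℝ (TanSp x) = n := by
  have : Fact (Module.finrank ℝ (Amb n) = n + 1) := ⟨finrank_euclideanSpace_fin⟩
  exact Submodule.finrank_orthogonal_span_singleton x.ne_zero

theorem inner_tau_homExt (hs : ContMDiff (𝓡 n) 𝓘(ℝ, ℝ) 4 s) (x : Sph n) (u w : TanSp x) :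
    inner ℝ (tau s x u) w = dd (u : Amb n) (dd (w : Amb n) (homExt s)) x :=
  inner_tau (hs.of_le (by norm_num)) x u w

theorem tau_isSymmetric (hs : ContMDiff (𝓡 n) 𝓘(ℝ, ℝ) 4 s) (x : Sph n) :
    (tau s x : TanSp x →ₗ[ℝ] TanSp x).IsSymmetric := by
  intro u w
  change inner ℝ (tau s x u) w = inner ℝ u (tau s x w)
  rw [inner_tau_homExt hs, real_inner_comm, inner_tau_homExt hs, dd_dd_homExt_comm hs _ _ x.ne_zero]

theorem homExt_eq (s : Sph n → ℝ) {y : Amb n} (hy : y ≠ 0) :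
    homExt s y = ‖y‖ * s (toSph y hy) := by
  rw [homExt, radialExt_of_ne s hy]

theorem norm_smul_toSph {y : Amb n} (hy : y ≠ 0) : ‖y‖ • (toSph y hy : Amb n) = y := by
  simp [toSph, smul_smul, mul_inv_cancel₀ (norm_ne_zero_iff.2 hy)]

theorem dd_dd_homExt_pos (hs : ContMDiff (𝓡 n) 𝓘(ℝ, ℝ) 4 s) (ht : TauPos s) {y u : Amb n}
    (hy : y ≠ 0) (hyu : inner ℝ y u = 0) (hu : u ≠ 0) : 0 < dd u (dd u (homExt s)) y := by
  have hu' : u ∈ TanSp (toSph y hy) := by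
    rw [mem_tanSp]; simp [toSph, real_inner_smul_left, hyu]
  have h1 := ht (toSph y hy) ⟨u, hu'⟩ (by simpa [Subtype.ext_iff] using hu)
  rw [inner_tau_homExt hs] at h1
  have hn : 0 < ‖y‖ := norm_pos_iff.2 hy
  have h2 := dd_dd_homExt_smul (s := s) ‖y‖ hn u u (toSph y hy).ne_zero
  rw [norm_smul_toSph] at h2
  rw [h2]
  exact mul_pos (inv_pos.2 hn) h1

/-- A lower bound for a support function along great circles. -/
theorem lt_apply_greatCircle (hs : ContMDiff (𝓡 n) 𝓘(ℝ, ℝ) 4 s) (ht : TauPos s) {x v : Amb n}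
    (hx : ‖x‖ = 1) (hv : ‖v‖ = 1) (hxv : inner ℝ x v = 0) {t : ℝ} (ht0 : 0 < t)
    (htπ : t ≤ Real.pi) :
    Real.cos t * homExt s x + Real.sin t * dd v (homExt s) x <
      homExt s (Real.cos t • x + Real.sin t • v) := by
  set c : ℝ → Amb n := fun t => Real.cos t • x + Real.sin t • v with hc
  set c' : ℝ → Amb n := fun t => -Real.sin t • x + Real.cos t • v with hc'
  have hcc : ∀ t, HasDerivAt c (c' t) t := fun t =>
    ((Real.hasDerivAt_cos t).smul_const x).add ((Real.hasDerivAt_sin t).smul_const v)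
  have hvx : inner ℝ v x = 0 := by rw [real_inner_comm, hxv]
  have hxx : inner ℝ x x = 1 := by rw [real_inner_self_eq_norm_sq, hx, one_pow]
  have hvv : inner ℝ v v = 1 := by rw [real_inner_self_eq_norm_sq, hv, one_pow]
  have hnc : ∀ t, inner ℝ (c t) (c t) = 1 := fun t => by
    simp only [hc, inner_add_left, inner_add_right, real_inner_smul_left, real_inner_smul_right,
      hxx, hvv, hxv, hvx]
    linear_combination Real.cos_sq_add_sin_sq t
  have hnc' : ∀ t, inner ℝ (c' t) (c' t) = 1 := fun t => by
    simp only [hc', inner_add_left, inner_add_right, real_inner_smul_left, real_inner_smul_right,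
      hxx, hvv, hxv, hvx]
    linear_combination Real.cos_sq_add_sin_sq t
  have horth : ∀ t, inner ℝ (c t) (c' t) = 0 := fun t => by
    simp only [hc, hc', inner_add_left, inner_add_right, real_inner_smul_left,
      real_inner_smul_right, hxx, hvv, hxv, hvx]
    ring
  have hc0 : ∀ t, c t ≠ 0 := fun t h => by have := hnc t; simp [h] at this
  have hc0' : ∀ t, c' t ≠ 0 := fun t h => by have := hnc' t; simp [h] at this
  set φ : ℝ → ℝ := fun t => homExt s (c t) with hφ
  set φ' : ℝ → ℝ := fun t => -Real.sin t * dd x (homExt s) (c t) +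
    Real.cos t * dd v (homExt s) (c t) with hφ'
  have h1 : ∀ t, HasDerivAt φ (φ' t) t := fun t => by
    refine (hasDerivAt_dd_curve (hcc t) ((contDiffOn_homExt hs).differentiableAt_punctured
      (by norm_num) (hc0 t))).congr_deriv ?_
    simp only [hc', dd_add_left, dd_smul_left, hφ']
  have hd : ∀ w t, HasDerivAt (fun t => dd w (homExt s) (c t))
      (dd (c' t) (dd w (homExt s)) (c t)) t := fun w t =>
    hasDerivAt_dd_curve (hcc t) ((contDiffOn_dd_homExt hs w).differentiableAt_punctured
      (by norm_num) (hc0 t))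
  have h2 : ∀ t, HasDerivAt φ' (dd (c' t) (dd (c' t) (homExt s)) (c t) - φ t) t := fun t => by
    refine (((Real.hasDerivAt_sin t).neg.mul (hd x t)).add
      ((Real.hasDerivAt_cos t).mul (hd v t))).congr_deriv ?_
    have e1 := dd_self_homExt hs (hc0 t)
    have e2 : dd (c t) (homExt s) (c t) =
        Real.cos t * dd x (homExt s) (c t) + Real.sin t * dd v (homExt s) (c t) := by
      conv_lhs => rw [show dd (c t) (homExt s) (c t) =
        dd (Real.cos t • x + Real.sin t • v) (homExt s) (c t) from rfl]
      rw [dd_add_left, dd_smul_left, dd_smul_left]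
    have e3 : dd (c' t) (dd (c' t) (homExt s)) (c t) =
        -Real.sin t * dd (c' t) (dd x (homExt s)) (c t) +
          Real.cos t * dd (c' t) (dd v (homExt s)) (c t) := by
      conv_lhs => rw [show dd (c' t) (dd (c' t) (homExt s)) (c t) =
        dd (c' t) (dd (-Real.sin t • x + Real.cos t • v) (homExt s)) (c t) from rfl]
      rw [dd_dd_homExt_add_right hs _ _ _ (hc0 t), dd_dd_homExt_smul_right hs _ _ _ (hc0 t),
        dd_dd_homExt_smul_right hs _ _ _ (hc0 t)]
    rw [e3, hφ]
    simp only [Pi.neg_apply]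
    linarith
  -- Sturm comparison: along the circle `φ'' + φ` is the Hessian in the unit tangent direction,
  -- hence positive. Pairing it with the solution `sin (t - r)` of the homogeneous equation gives a
  -- strictly increasing `ψ` whose end values are the two sides of the claim.
  set ψ : ℝ → ℝ := fun r => φ' r * Real.sin (t - r) + φ r * Real.cos (t - r) with hψ
  have hsub : ∀ r, HasDerivAt (fun r => t - r) (-1) r := fun r => by
    simpa using (hasDerivAt_id r).const_sub t
  have h3 : ∀ r, HasDerivAt ψ (dd (c' r) (dd (c' r) (homExt s)) (c r) * Real.sin (t - r)) r :=
    fun r => by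
    have hS := (Real.hasDerivAt_sin (t - r)).comp r (hsub r)
    have hC := (Real.hasDerivAt_cos (t - r)).comp r (hsub r)
    refine (((h2 r).mul hS).add ((h1 r).mul hC)).congr_deriv ?_
    simp only [Function.comp]
    ring
  have h4 : StrictMonoOn ψ (Set.Icc 0 t) := by
    refine strictMonoOn_of_deriv_pos (convex_Icc 0 t)
      (fun r _ => (h3 r).continuousAt.continuousWithinAt) fun r hr => ?_
    rw [interior_Icc] at hr
    rw [(h3 r).deriv]
    exact mul_pos (dd_dd_homExt_pos hs ht (hc0 r) (horth r) (hc0' r))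
      (Real.sin_pos_of_pos_of_lt_pi (by linarith [hr.2]) (by linarith [hr.1]))
  have h5 := h4 ⟨le_rfl, ht0.le⟩ ⟨ht0.le, le_rfl⟩ ht0
  simp only [hψ, hφ, hφ', hc, sub_self, sub_zero, Real.sin_zero, Real.cos_zero, zero_smul,
    one_smul, add_zero] at h5
  linarith

theorem exists_unit_orthogonal (hn : 1 ≤ n) (x : Sph n) :
    ∃ v : Amb n, ‖v‖ = 1 ∧ inner ℝ (x : Amb n) v = 0 := by
  have : Nontrivial (TanSp x) := Module.nontrivial_of_finrank_pos (R := ℝ)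
    (by rw [finrank_tanSp]; omega)
  obtain ⟨v, hv⟩ := exists_norm_eq (TanSp x) zero_le_one
  exact ⟨v, by simpa using hv, mem_tanSp.1 v.2⟩

/-- Two points of the sphere are joined by an arc of a great circle. -/
theorem exists_greatCircle (hn : 1 ≤ n) (x z : Sph n) :
    ∃ v : Amb n, ‖v‖ = 1 ∧ inner ℝ (x : Amb n) v = 0 ∧ ∃ t ∈ Set.Icc 0 Real.pi,
      (z : Amb n) = Real.cos t • (x : Amb n) + Real.sin t • v := by
  set a : ℝ := inner ℝ (x : Amb n) (z : Amb n) with ha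
  have hxx : inner ℝ (x : Amb n) (x : Amb n) = 1 := by
    rw [real_inner_self_eq_norm_sq, x.norm_eq, one_pow]
  have hzz : inner ℝ (z : Amb n) (z : Amb n) = 1 := by
    rw [real_inner_self_eq_norm_sq, z.norm_eq, one_pow]
  have hzx : inner ℝ (z : Amb n) (x : Amb n) = a := real_inner_comm _ _
  have hw : ‖(z : Amb n) - a • (x : Amb n)‖ ^ 2 = 1 - a ^ 2 := by
    rw [← real_inner_self_eq_norm_sq]
    simp only [inner_sub_left, inner_sub_right, real_inner_smul_left, real_inner_smul_right, hxx,
      hzz, hzx, ← ha]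
    ring
  have ha2 : a ^ 2 ≤ 1 := by nlinarith [sq_nonneg ‖(z : Amb n) - a • (x : Amb n)‖]
  have ha1 : -1 ≤ a ∧ a ≤ 1 := abs_le.1 ((sq_le_one_iff_abs_le_one a).1 ha2)
  have hsin : Real.sin (Real.arccos a) = ‖(z : Amb n) - a • (x : Amb n)‖ := by
    rw [Real.sin_arccos, ← hw, Real.sqrt_sq (norm_nonneg _)]
  have hcos := Real.cos_arccos ha1.1 ha1.2
  have hmem : Real.arccos a ∈ Set.Icc 0 Real.pi := ⟨Real.arccos_nonneg a, Real.arccos_le_pi a⟩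
  by_cases h0 : (z : Amb n) - a • (x : Amb n) = 0
  · obtain ⟨v, hv, hxv⟩ := exists_unit_orthogonal hn x
    refine ⟨v, hv, hxv, Real.arccos a, hmem, ?_⟩
    rw [hsin, hcos, h0, norm_zero, zero_smul, add_zero]
    exact sub_eq_zero.1 h0
  · have hne : ‖(z : Amb n) - a • (x : Amb n)‖ ≠ 0 := norm_ne_zero_iff.2 h0
    refine ⟨‖(z : Amb n) - a • (x : Amb n)‖⁻¹ • ((z : Amb n) - a • (x : Amb n)), ?_, ?_,
      Real.arccos a, hmem, ?_⟩
    · rw [norm_smul, norm_inv, norm_norm, inv_mul_cancel₀ hne]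
    · rw [real_inner_smul_right, inner_sub_right, real_inner_smul_right, hxx, ← ha]; simp
    · rw [hsin, hcos, smul_smul, mul_inv_cancel₀ hne, one_smul]; abel

/-- Half a great circle leads from `x` to `-x` and gives `s (-x) > -s x`; evenness then forces `s x
> 0`. -/
theorem support_pos (hn : 1 ≤ n) (hs : ContMDiff (𝓡 n) 𝓘(ℝ, ℝ) 4 s) (he : IsEven s)
    (ht : TauPos s) (x : Sph n) : 0 < s x := by
  obtain ⟨v, hv, hxv⟩ := exists_unit_orthogonal hn x
  have h := lt_apply_greatCircle hs ht x.norm_eq hv hxv Real.pi_pos le_rfl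
  have h1 : Real.cos Real.pi • (x : Amb n) + Real.sin Real.pi • v = ((-x : Sph n) : Amb n) := by
    simp
  rw [h1, homExt_coe, homExt_coe, he x] at h
  simp at h
  linarith

end Support

/-! ### Eigenframes and the differentiated equation. -/

section Frame

variable {n k : ℕ} {s f : Sph n → ℝ} {p : ℝ}

/-- `e` is an orthonormal eigenbasis of `τ[s]` at `x`, with positive eigenvalues `l`. -/
structure IsEigenframe (s : Sph n → ℝ) (x : Sph n) (e : Fin n → Amb n) (l : Fin n → ℝ) :
    Prop where
  orthonormal : Orthonormal ℝ e
  inner_base : ∀ i, inner ℝ (x : Amb n) (e i) = 0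
  pos : ∀ i, 0 < l i
  hess : ∀ i w, dd w (dd (e i) (homExt s)) x = l i * inner ℝ (e i) w
  expand : ∀ w, w = inner ℝ (x : Amb n) w • (x : Amb n) + ∑ i, inner ℝ (e i) w • e i
  sigma_div : ∀ k ≤ n, sigma n (tau s x : TanSp x →ₗ[ℝ] TanSp x) /
    sigma (n - k) (tau s x : TanSp x →ₗ[ℝ] TanSp x) = (invEsymm k l)⁻¹

theorem exists_isEigenframe (hs : ContMDiff (𝓡 n) 𝓘(ℝ, ℝ) 4 s) (ht : TauPos s) (x : Sph n) :
    ∃ e l, IsEigenframe s x e l := by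
  have hT := tau_isSymmetric hs x
  have hn := finrank_tanSp x
  set b := hT.eigenvectorBasis hn
  set l := hT.eigenvalues hn
  have hTb : ∀ i, tau s x (b i) = l i • b i := fun i => hT.apply_eigenvectorBasis hn i
  have hpos : ∀ i, 0 < l i := by
    intro i
    have := ht x (b i) (b.orthonormal.ne_zero i)
    rw [hTb, real_inner_smul_left, real_inner_self_eq_norm_sq, b.orthonormal.norm_eq_one] at this
    simpa using this
  have hxb : ∀ i, inner ℝ (x : Amb n) (b i : Amb n) = 0 := fun i => mem_tanSp.1 (b i).2
  have hxx : inner ℝ (x : Amb n) (x : Amb n) = 1 := by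
    rw [real_inner_self_eq_norm_sq, x.norm_eq, one_pow]
  have hexp : ∀ w : Amb n,
      w = inner ℝ (x : Amb n) w • (x : Amb n) + ∑ i, inner ℝ (b i : Amb n) w • (b i : Amb n) := by
    intro w
    have hw : w - inner ℝ (x : Amb n) w • (x : Amb n) ∈ TanSp x := by
      rw [mem_tanSp, inner_sub_right, real_inner_smul_right, hxx]; simp
    have h1 := congrArg (Subtype.val) (b.sum_repr' ⟨_, hw⟩)
    simp only [Submodule.coe_sum, Submodule.coe_smul, Submodule.coe_inner] at h1
    refine sub_eq_iff_eq_add'.1 (h1.symm.trans ?_)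
    refine Finset.sum_congr rfl fun i _ => ?_
    rw [inner_sub_right, real_inner_smul_right, real_inner_comm (x : Amb n), hxb i]
    simp
  refine ⟨fun i => b i, l, ?_, hxb, hpos, fun i w => ?_, hexp, fun k hk => ?_⟩
  · exact b.orthonormal.comp_linearIsometry (TanSp x).subtypeₗᵢ
  · have hx0 := x.ne_zero
    have h1 : ∀ u : TanSp x, dd (u : Amb n) (dd (b i : Amb n) (homExt s)) x =
        l i * inner ℝ (b i : Amb n) (u : Amb n) := by
      intro u
      rw [dd_dd_homExt_comm hs _ _ hx0, ← inner_tau_homExt hs, hTb, real_inner_smul_left]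
      rfl
    conv_lhs => rw [hexp w]
    conv_rhs => rw [hexp w]
    rw [dd_add_left, dd_smul_left, dd_sum_left, dd_self_dd_homExt hs _ hx0, mul_zero, zero_add,
      inner_add_right, real_inner_smul_right, real_inner_comm (x : Amb n) (b i : Amb n), hxb i,
      mul_zero, zero_add,
      inner_sum, Finset.mul_sum]
    refine Finset.sum_congr rfl fun j _ => ?_
    rw [h1, real_inner_smul_right]
    ring
  · exact sigma_div_sigma hT hn hk hpos

/-- The point and frame here need not be those at which `l` are eigenvalues, so the tangent plane
taken at one point can be compared with the operator at nearby points. -/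
theorem log_sigma_div_sigma_tau_le (hs : ContMDiff (𝓡 n) 𝓘(ℝ, ℝ) 4 s) (ht : TauPos s) (hk : k ≤ n)
    (x : Sph n) {e : Fin n → Amb n} (he : Orthonormal ℝ e)
    (hxe : ∀ i, inner ℝ (x : Amb n) (e i) = 0) {l : Fin n → ℝ} (hl : ∀ i, 0 < l i) :
    Real.log (sigma n (tau s x : TanSp x →ₗ[ℝ] TanSp x) /
        sigma (n - k) (tau s x : TanSp x →ₗ[ℝ] TanSp x)) ≤
      -Real.log (invEsymm k l) +
        ∑ i, invWeight k l i * (dd (e i) (dd (e i) (homExt s)) x - l i) := by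
  let e' : Fin n → TanSp x := fun i => ⟨e i, mem_tanSp.2 (hxe i)⟩
  have he' : Orthonormal ℝ e' :=
    (LinearIsometry.orthonormal_comp_iff (TanSp x).subtypeₗᵢ).1 he
  have hn := finrank_tanSp x
  have hc : Fintype.card (Fin n) = Module.finrank ℝ (TanSp x) := by rw [hn, Fintype.card_fin]
  have hspan : ⊤ ≤ Submodule.span ℝ (Set.range e') :=
    (he'.linearIndependent.span_eq_top_of_card_eq_finrank' hc).ge
  have h := log_sigma_div_sigma_le (tau_isSymmetric hs x) hn hk (fun u hu => ht x u hu)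
    (OrthonormalBasis.mk he' hspan) hl
  refine h.trans (le_of_eq ?_)
  congr 1
  refine Finset.sum_congr rfl fun i _ => ?_
  rw [OrthonormalBasis.coe_mk]
  congr 2
  exact inner_tau_homExt hs x (e' i) (e' i)

theorem IsEigenframe.solves (hk : k ≤ n) (hsol : SolvesEq k p f s) {x : Sph n} {e : Fin n → Amb n}
    {l : Fin n → ℝ} (hF : IsEigenframe s x e l) : s x ^ (p - 1) * f x = (invEsymm k l)⁻¹ := by
  rw [← hsol x, hF.sigma_div k hk]

theorem IsEigenframe.norm_line {x : Sph n} {e : Fin n → Amb n} {l : Fin n → ℝ}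
    (hF : IsEigenframe s x e l) (j : Fin n) (t : ℝ) : ‖(x : Amb n) + t • e j‖ = √(1 + t ^ 2) := by
  rw [eq_comm, Real.sqrt_eq_iff_mul_self_eq (by positivity) (norm_nonneg _), ← sq,
    norm_add_sq_real, real_inner_smul_right, hF.inner_base, norm_smul, hF.orthonormal.norm_eq_one,
    x.norm_eq]
  simp

/-- The logarithm of the equation along a line tangent to the sphere, bounded by the tangent plane
of the curvature function at the base point. -/
theorem IsEigenframe.log_solves_line_le (hs : ContMDiff (𝓡 n) 𝓘(ℝ, ℝ) 4 s) (ht : TauPos s)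
    (hk : k ≤ n) (hspos : ∀ x, 0 < s x) (hfpos : ∀ x, 0 < f x) (hsol : SolvesEq k p f s)
    {x : Sph n} {e : Fin n → Amb n} {l : Fin n → ℝ} (hF : IsEigenframe s x e l) (j : Fin n)
    (t : ℝ) :
    (p - 1) * (Real.log (homExt s (x + t • e j)) - Real.log √(1 + t ^ 2)) +
        Real.log (radialExt f (x + t • e j)) ≤
      -Real.log (invEsymm k l) + ∑ i, invWeight k l i *
        ((if i = j then √(1 + t ^ 2) * √(1 + t ^ 2) * √(1 + t ^ 2) else √(1 + t ^ 2)) *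
          dd (e i) (dd (e i) (homExt s)) (x + t • e j) - l i) := by
  set ν := √(1 + t ^ 2) with hν
  set y : Amb n := (x : Amb n) + t • e j with hy
  have hν0 : 0 < ν := Real.sqrt_pos.2 (by positivity)
  have hν2 : ν ^ 2 = 1 + t ^ 2 := Real.sq_sqrt (by positivity)
  have hyν : ‖y‖ = ν := hF.norm_line j t
  have hy0 : y ≠ 0 := by rw [← norm_pos_iff, hyν]; exact hν0
  set z := toSph y hy0 with hz
  have hzy : (z : Amb n) = ν⁻¹ • y := by rw [← hyν]; rfl
  have hej : inner ℝ (e j) (e j) = 1 := by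
    rw [real_inner_self_eq_norm_sq, hF.orthonormal.norm_eq_one, one_pow]
  have hxx : inner ℝ (x : Amb n) (x : Amb n) = 1 := by
    rw [real_inner_self_eq_norm_sq, x.norm_eq, one_pow]
  have hex : ∀ i, inner ℝ (e i) (x : Amb n) = 0 := fun i => by
    rw [real_inner_comm, hF.inner_base]
  have hij : ∀ i i', i ≠ i' → inner ℝ (e i) (e i') = 0 := fun i i' h => hF.orthonormal.2 h
  -- An orthonormal tangent frame at `z = y / ν`. Moving along `e j` tilts the tangent space only in
  -- the plane of `x` and `e j`, so a single vector has to be rotated.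
  let e' : Fin n → Amb n := fun i => if i = j then ν⁻¹ • (e j - t • (x : Amb n)) else e i
  have hself : inner ℝ (e j - t • (x : Amb n)) (e j - t • (x : Amb n)) = ν ^ 2 := by
    simp only [inner_sub_left, inner_sub_right, real_inner_smul_left, real_inner_smul_right, hej,
      hxx, hex, hF.inner_base, hν2]
    ring
  have hon : Orthonormal ℝ e' := by
    refine ⟨fun i => ?_, fun i i' hii => ?_⟩
    · by_cases h : i = j
      · have h1 : ‖e j - t • (x : Amb n)‖ = ν := by
          rw [← sq_eq_sq₀ (norm_nonneg _) hν0.le, ← real_inner_self_eq_norm_sq, hself]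
        simp only [e', if_pos h, norm_smul, h1, norm_inv, Real.norm_of_nonneg hν0.le]
        exact inv_mul_cancel₀ hν0.ne'
      · simp only [e', if_neg h]; exact hF.orthonormal.1 i
    · by_cases h : i = j <;> by_cases h' : i' = j
      · exact absurd (h.trans h'.symm) hii
      · simp only [e', if_pos h, if_neg h']
        rw [real_inner_smul_left, inner_sub_left, real_inner_smul_left, hF.inner_base,
          hij _ _ (Ne.symm h')]
        simp
      · simp only [e', if_neg h, if_pos h']
        rw [real_inner_smul_right, inner_sub_right, real_inner_smul_right, hex, hij _ _ h]
        simp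
      · simp only [e', if_neg h, if_neg h']
        exact hij _ _ hii
  have hze : ∀ i, inner ℝ (z : Amb n) (e' i) = 0 := by
    intro i
    rw [hzy, real_inner_smul_left]
    by_cases h : i = j
    · simp only [e', if_pos h, hy, real_inner_smul_right, inner_add_left, inner_sub_right,
        real_inner_smul_left, hex, hF.inner_base, hxx, hej]
      ring
    · simp only [e', if_neg h, hy, inner_add_left, real_inner_smul_left, hF.inner_base,
        hij _ _ (Ne.symm h)]
      ring
  have hmain := log_sigma_div_sigma_tau_le hs ht hk z hon hze hF.pos
  rw [hsol z, Real.log_mul (Real.rpow_pos_of_pos (hspos z) _).ne' (hfpos z).ne',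
    Real.log_rpow (hspos z)] at hmain
  have hsz : Real.log (homExt s y) - Real.log ν = Real.log (s z) := by
    rw [homExt_eq s hy0, hyν, Real.log_mul hν0.ne' (hspos _).ne']; ring
  rw [hsz, radialExt_of_ne f hy0]
  refine hmain.trans (le_of_eq ?_)
  congr 1
  refine Finset.sum_congr rfl fun i _ => ?_
  congr 2
  have hscale : ∀ u, dd u (dd u (homExt s)) z = ν * dd u (dd u (homExt s)) y := by
    intro u
    rw [hzy, dd_dd_homExt_smul _ (inv_pos.2 hν0) u u hy0, inv_inv]
  rw [hscale]
  by_cases h : i = j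
  · have h1 : ν⁻¹ • (e j - t • (x : Amb n)) = ν • e j + (-(ν⁻¹ * t)) • y := by
      have : ν • e j = (ν⁻¹ * (1 + t ^ 2)) • e j := by
        congr 1; rw [← hν2]; field_simp
      rw [this, hy]; module
    simp only [e', if_pos h]
    rw [h1, dd_dd_homExt_add_smul_self hs _ _ hy0, dd_smul_left,
      dd_dd_homExt_smul_right hs _ _ _ hy0, h]
    ring
  · simp only [e', if_neg h]

/-- First and second derivative of the logarithm of the equation in an eigendirection. -/
theorem IsEigenframe.derivatives (hs : ContMDiff (𝓡 n) 𝓘(ℝ, ℝ) 4 s)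
    (hf : ContMDiff (𝓡 n) 𝓘(ℝ, ℝ) 2 f) (ht : TauPos s)
    (hk : k ≤ n) (hspos : ∀ x, 0 < s x) (hfpos : ∀ x, 0 < f x) (hsol : SolvesEq k p f s)
    {x : Sph n} {e : Fin n → Amb n} {l : Fin n → ℝ} (hF : IsEigenframe s x e l) (j : Fin n) :
    (p - 1) * (dd (e j) (homExt s) x / s x) + dd (e j) (radialExt f) x / f x =
        ∑ i, invWeight k l i * dd (e j) (dd (e i) (dd (e i) (homExt s))) x ∧
      (p - 1) * (l j / s x - (dd (e j) (homExt s) x / s x) ^ 2 - 1) +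
          (dd (e j) (dd (e j) (radialExt f)) x / f x - (dd (e j) (radialExt f) x / f x) ^ 2) ≤
        ∑ i, invWeight k l i * (dd (e j) (dd (e j) (dd (e i) (dd (e i) (homExt s)))) x +
          (if i = j then 3 else 1) * l i) := by
  have hx0 := x.ne_zero
  have hll : ∀ i, dd (e i) (dd (e i) (homExt s)) x = l i := fun i => by
    rw [hF.hess, real_inner_self_eq_norm_sq, hF.orthonormal.norm_eq_one]; simp
  have J1 := (hasJet_line isOpen_punctured (contDiffOn_homExt_two hs) hx0 (e j)).log
    (by rw [homExt_coe]; exact (hspos x).ne')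
  have J2 := (hasJet_line isOpen_punctured (contDiffOn_radialExt hf) hx0 (e j)).log
    (by rw [radialExt_coe]; exact (hfpos x).ne')
  have Jν := hasJet_sqrt_one_add_sq
  have J3 := (Jν.log one_ne_zero).const_mul (-1)
  have J4 := ((J1.add J3).const_mul (p - 1)).add J2
  -- The constants `3` and `1` are the second derivatives at `0` of `(1 + t²)^(3/2)` and `(1 +
  -- t²)^(1/2)`.
  have J5 : ∀ i, HasJet (fun t => (if i = j then √(1 + t ^ 2) * √(1 + t ^ 2) * √(1 + t ^ 2)
      else √(1 + t ^ 2)) * dd (e i) (dd (e i) (homExt s)) (x + t • e j)) (l i)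
      (dd (e j) (dd (e i) (dd (e i) (homExt s))) x)
      (dd (e j) (dd (e j) (dd (e i) (dd (e i) (homExt s)))) x + (if i = j then 3 else 1) * l i) := by
    intro i
    have Jh := hasJet_line isOpen_punctured (contDiffOn_dd_dd_homExt hs (e i) (e i)) hx0 (e j)
    by_cases h : i = j
    · have := ((Jν.mul Jν).mul Jν).mul Jh
      simp only [if_pos h]
      convert this using 1 <;> rw [hll] <;> ring
    · have := Jν.mul Jh
      simp only [if_neg h]
      convert this using 1 <;> rw [hll] <;> ring
  have J6 := (HasJet.sum Finset.univ fun i _ => (J5 i).const_mul (invWeight k l i)).const_mul (-1)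
  have J := J4.add J6
  -- The logarithm of the equation minus its linear upper bound is maximal at `t = 0`, where the
  -- tangent plane touches.
  have hmax : IsLocalMax (fun t => ((p - 1) * (Real.log (homExt s (x + t • e j)) +
      -1 * Real.log √(1 + t ^ 2)) + Real.log (radialExt f (x + t • e j))) +
      -1 * ∑ i, invWeight k l i *
        ((if i = j then √(1 + t ^ 2) * √(1 + t ^ 2) * √(1 + t ^ 2) else √(1 + t ^ 2)) *
          dd (e i) (dd (e i) (homExt s)) (x + t • e j))) 0 := by
    refine Filter.Eventually.of_forall fun t => ?_
    have h1 := hF.log_solves_line_le hs ht hk hspos hfpos hsol j t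
    have h2 : (p - 1) * Real.log (s x) + Real.log (f x) = -Real.log (invEsymm k l) := by
      rw [← Real.log_inv, ← hF.solves hk hsol,
        Real.log_mul (Real.rpow_pos_of_pos (hspos x) _).ne' (hfpos x).ne',
        Real.log_rpow (hspos x)]
    simp_rw [mul_sub, Finset.sum_sub_distrib] at h1
    have h3 : ∑ i, invWeight k l i * ((if i = j then √(1 + (0 : ℝ) ^ 2) * √(1 + (0 : ℝ) ^ 2) *
        √(1 + (0 : ℝ) ^ 2) else √(1 + (0 : ℝ) ^ 2)) *
          dd (e i) (dd (e i) (homExt s)) (x + (0 : ℝ) • e j)) = ∑ i, invWeight k l i * l i := by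
      refine Finset.sum_congr rfl fun i _ => ?_
      simp [hll]
    simp only
    rw [h3]
    simp only [zero_smul, add_zero, homExt_coe, radialExt_coe]
    have h4 : Real.log √(1 + (0 : ℝ) ^ 2) = 0 := by simp
    rw [h4]
    linarith
  obtain ⟨h1, h2⟩ := J.of_isLocalMax hmax
  simp only [homExt_coe, radialExt_coe, hll] at h1 h2
  constructor
  · linarith
  · have : (p - 1) * (l j / s x - (dd (e j) (homExt s) x / s x) ^ 2 + -1 * (1 / 1 - (0 / 1) ^ 2)) =
        (p - 1) * (l j / s x - (dd (e j) (homExt s) x / s x) ^ 2 - 1) := by ring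
    rw [this] at h2
    linarith

end Frame

/-! ### Pointwise bounds from the `C²` norm. -/

section C2Norm

variable {n : ℕ} {f : Sph n → ℝ} {M : ℝ}

theorem bddAbove_range_norm_of_continuousOn {F : Type*} [NormedAddCommGroup F] {g : Amb n → F}
    (hg : ContinuousOn g {0}ᶜ) : BddAbove (Set.range fun x : Sph n => ‖g x‖) := by
  have h : Continuous fun x : Sph n => ‖g x‖ :=
    (hg.comp_continuous continuous_subtype_val Sph.ne_zero).norm
  exact (isCompact_range h).bddAbove

theorem norm_sphereHess_le (f : Sph n → ℝ) (x : Sph n) :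
    ‖sphereHess f x‖ ≤ ‖fderiv ℝ (sphereGrad f) (x : Amb n)‖ := by
  refine ContinuousLinearMap.opNorm_le_bound _ (norm_nonneg _) fun u => ?_
  have h : sphereHess f x u = (TanSp x).orthogonalProjectionOnto
    (fderiv ℝ (sphereGrad f) (x : Amb n) (u : Amb n)) := rfl
  rw [h]
  exact (Submodule.norm_orthogonalProjectionOnto_apply_le _ _).trans
    ((fderiv ℝ (sphereGrad f) (x : Amb n)).le_opNorm (u : Amb n))

/-- A real supremum of an unbounded family is `0` by convention, so boundedness must come first;
compactness of the sphere and continuity of the derivatives supply it. -/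
theorem c2Norm_bounds (hf : ContMDiff (𝓡 n) 𝓘(ℝ, ℝ) 2 f) (hM : c2Norm f ≤ M) (x : Sph n) :
    |f x| ≤ M ∧ ‖sphereGrad f (x : Amb n)‖ ≤ M ∧ ‖sphereHess f x‖ ≤ M := by
  have hr := contDiffOn_radialExt hf
  have hG := contDiffOn_sphereGrad hr
  have b1 : BddAbove (Set.range fun x : Sph n => |f x|) := by
    have := bddAbove_range_norm_of_continuousOn hr.continuousOn
    simpa only [radialExt_coe, Real.norm_eq_abs] using this
  have b2 := bddAbove_range_norm_of_continuousOn hG.continuousOn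
  have b3 : BddAbove (Set.range fun x : Sph n => ‖sphereHess f x‖) := by
    have h := bddAbove_range_norm_of_continuousOn
      (hG.fderiv_of_isOpen isOpen_punctured (m := 0) (by norm_num)).continuousOn
    exact h.range_mono _ fun x => norm_sphereHess_le f x
  have n1 : 0 ≤ ⨆ x : Sph n, |f x| := Real.iSup_nonneg fun x => abs_nonneg _
  have n2 : 0 ≤ ⨆ x : Sph n, ‖sphereGrad f (x : Amb n)‖ := Real.iSup_nonneg fun x => norm_nonneg _
  have n3 : 0 ≤ ⨆ x : Sph n, ‖sphereHess f x‖ := Real.iSup_nonneg fun x => norm_nonneg (sphereHess f x)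
  have l1 := le_ciSup b1 x
  have l2 := le_ciSup b2 x
  have l3 := le_ciSup b3 x
  unfold c2Norm at hM
  exact ⟨by linarith, by linarith, by linarith⟩

theorem abs_dd_radialExt_le (hf : ContMDiff (𝓡 n) 𝓘(ℝ, ℝ) 2 f) (hM : c2Norm f ≤ M) (x : Sph n)
    (v : Amb n) : |dd v (radialExt f) x| ≤ M * ‖v‖ := by
  rw [← inner_sphereGrad]
  exact (abs_real_inner_le_norm _ _).trans
    (mul_le_mul_of_nonneg_right (c2Norm_bounds hf hM x).2.1 (norm_nonneg _))

theorem abs_dd_dd_radialExt_le (hf : ContMDiff (𝓡 n) 𝓘(ℝ, ℝ) 2 f) (hM : c2Norm f ≤ M) (x : Sph n)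
    {v : Amb n} (hv : inner ℝ (x : Amb n) v = 0) (hv1 : ‖v‖ = 1) :
    |dd v (dd v (radialExt f)) x| ≤ M := by
  let v' : TanSp x := ⟨v, mem_tanSp.2 hv⟩
  have hv' : ‖v'‖ = 1 := hv1
  have h := inner_sphereHess f x v' v'
  rw [inner_fderiv_sphereGrad (contDiffOn_radialExt hf) x.ne_zero] at h
  change |dd (v' : Amb n) (dd (v' : Amb n) (radialExt f)) x| ≤ M
  rw [← h]
  refine (abs_real_inner_le_norm _ _).trans ?_
  rw [hv', mul_one]
  refine (ContinuousLinearMap.le_opNorm _ _).trans ?_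
  rw [hv', mul_one]
  exact (c2Norm_bounds hf hM x).2.2

end C2Norm

/-! ### The equation at extrema of `s`. -/

section Extrema

variable {n k : ℕ} {s f : Sph n → ℝ} {p : ℝ}

theorem IsEigenframe.dd_dd_self {x : Sph n} {e : Fin n → Amb n} {l : Fin n → ℝ}
    (hF : IsEigenframe s x e l) (i : Fin n) : dd (e i) (dd (e i) (homExt s)) x = l i := by
  rw [hF.hess, real_inner_self_eq_norm_sq, hF.orthonormal.norm_eq_one]; simp

theorem IsEigenframe.line_ne_zero {x : Sph n} {e : Fin n → Amb n} {l : Fin n → ℝ}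
    (hF : IsEigenframe s x e l) (j : Fin n) (t : ℝ) : (x : Amb n) + t • e j ≠ 0 := by
  rw [← norm_pos_iff, hF.norm_line]
  exact Real.sqrt_pos.2 (by positivity)

/-- The two-jet of `log s` in an eigendirection. -/
theorem IsEigenframe.hasJet_log (hs : ContMDiff (𝓡 n) 𝓘(ℝ, ℝ) 4 s) (hspos : ∀ x, 0 < s x)
    {x : Sph n} {e : Fin n → Amb n} {l : Fin n → ℝ} (hF : IsEigenframe s x e l) (j : Fin n) :
    HasJet (fun t => Real.log (s (toSph (x + t • e j) (hF.line_ne_zero j t))))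
      (Real.log (s x)) (dd (e j) (homExt s) x / s x)
      (l j / s x - (dd (e j) (homExt s) x / s x) ^ 2 - 1) := by
  have hx0 := x.ne_zero
  have J1 := (hasJet_line isOpen_punctured (contDiffOn_homExt_two hs) hx0 (e j)).log
    (by rw [homExt_coe]; exact (hspos x).ne')
  have J3 := (hasJet_sqrt_one_add_sq.log one_ne_zero).const_mul (-1)
  have J := J1.add J3
  have h : (fun t => Real.log (s (toSph (x + t • e j) (hF.line_ne_zero j t)))) =
      fun t => Real.log (homExt s (x + t • e j)) + -1 * Real.log √(1 + t ^ 2) := by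
    funext t
    rw [homExt_eq s (hF.line_ne_zero j t), hF.norm_line,
      Real.log_mul (Real.sqrt_pos.2 (by positivity)).ne' (hspos _).ne']
    ring
  rw [h]
  convert J using 1
  · simp [homExt_coe]
  · simp [homExt_coe]
  · rw [homExt_coe, hF.dd_dd_self]; ring

theorem toSph_line_zero {x : Sph n} {v : Amb n} (h : (x : Amb n) + (0 : ℝ) • v ≠ 0) :
    toSph ((x : Amb n) + (0 : ℝ) • v) h = x := by
  apply Subtype.ext; simp [toSph, x.norm_eq]

theorem IsEigenframe.le_of_isMax (hs : ContMDiff (𝓡 n) 𝓘(ℝ, ℝ) 4 s) (hspos : ∀ x, 0 < s x)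
    {x : Sph n} {e : Fin n → Amb n} {l : Fin n → ℝ} (hF : IsEigenframe s x e l)
    (hmax : ∀ z, s z ≤ s x) (j : Fin n) : l j ≤ s x := by
  obtain ⟨h1, h2⟩ := (hF.hasJet_log hs hspos j).of_isLocalMax <| Filter.Eventually.of_forall
    fun t => by
      simp only [toSph_line_zero]
      exact Real.log_le_log (hspos _) (hmax _)
  rw [h1] at h2
  have h3 : l j / s x ≤ 1 := by linarith
  rwa [div_le_one (hspos x)] at h3

theorem IsEigenframe.le_of_isMin (hs : ContMDiff (𝓡 n) 𝓘(ℝ, ℝ) 4 s) (hspos : ∀ x, 0 < s x)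
    {x : Sph n} {e : Fin n → Amb n} {l : Fin n → ℝ} (hF : IsEigenframe s x e l)
    (hmin : ∀ z, s x ≤ s z) (j : Fin n) : s x ≤ l j := by
  obtain ⟨h1, h2⟩ := ((hF.hasJet_log hs hspos j).const_mul (-1)).of_isLocalMax <|
    Filter.Eventually.of_forall fun t => by
      simp only [toSph_line_zero]
      have := Real.log_le_log (hspos _) (hmin (toSph (x + t • e j) (hF.line_ne_zero j t)))
      linarith
  have h1' : dd (e j) (homExt s) x / s x = 0 := by linarith
  rw [h1'] at h2
  have h3 : 1 ≤ l j / s x := by linarith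
  rwa [one_le_div (hspos x)] at h3

/-- With all eigenvalues at most `s x`, the curvature quotient is at most `s x ^ k`; dividing the
equation by `s x ^ (p - 1)` leaves the exponent `k + 1 - p`. -/
theorem le_rpow_of_isMax (hs : ContMDiff (𝓡 n) 𝓘(ℝ, ℝ) 4 s) (ht : TauPos s) (hk : k ≤ n)
    (hspos : ∀ x, 0 < s x) (hsol : SolvesEq k p f s) {x : Sph n} (hmax : ∀ z, s z ≤ s x) :
    f x ≤ s x ^ ((k : ℝ) + 1 - p) := by
  obtain ⟨e, l, hF⟩ := exists_isEigenframe hs ht x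
  have h1 := hF.solves hk hsol
  have hk' : k ≤ Fintype.card (Fin n) := by simpa using hk
  have h2 := le_invEsymm_of_le hk' hF.pos (hF.le_of_isMax hs hspos hmax)
  have h3 : (invEsymm k l)⁻¹ ≤ s x ^ (k : ℝ) := by
    rw [Real.rpow_natCast, inv_le_comm₀ (invEsymm_pos hk' hF.pos) (pow_pos (hspos x) k), ← inv_pow]
    exact h2
  have h4 : (k : ℝ) + 1 - p = k - (p - 1) := by ring
  rw [h4, Real.rpow_sub (hspos x), le_div_iff₀ (Real.rpow_pos_of_pos (hspos x) _), mul_comm, h1]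
  exact h3

/-- The mirror image of `le_rpow_of_isMax`; the binomial coefficient counts the terms of `invEsymm`.
-/
theorem rpow_le_of_isMin (hs : ContMDiff (𝓡 n) 𝓘(ℝ, ℝ) 4 s) (ht : TauPos s) (hk : k ≤ n)
    (hspos : ∀ x, 0 < s x) (hsol : SolvesEq k p f s) {x : Sph n} (hmin : ∀ z, s x ≤ s z) :
    s x ^ ((k : ℝ) + 1 - p) ≤ n.choose k * f x := by
  obtain ⟨e, l, hF⟩ := exists_isEigenframe hs ht x
  have h1 := hF.solves hk hsol
  have hk' : k ≤ Fintype.card (Fin n) := by simpa using hk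
  have h2 := invEsymm_le_of_le (k := k) hF.pos (hspos x) (hF.le_of_isMin hs hspos hmin)
  have hN : (0 : ℝ) < n.choose k := by exact_mod_cast Nat.choose_pos hk
  have h3 : s x ^ (k : ℝ) ≤ n.choose k * (invEsymm k l)⁻¹ := by
    have hq := invEsymm_pos hk' hF.pos
    rw [Real.rpow_natCast, ← div_eq_mul_inv, le_div_iff₀ hq]
    rw [Fintype.card_fin] at h2
    calc s x ^ k * invEsymm k l ≤ s x ^ k * (n.choose k * (s x)⁻¹ ^ k) :=
          mul_le_mul_of_nonneg_left h2 (pow_pos (hspos x) k).le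
      _ = n.choose k * (s x * (s x)⁻¹) ^ k := by rw [mul_pow]; ring
      _ = n.choose k := by rw [mul_inv_cancel₀ (hspos x).ne', one_pow, mul_one]
  have h4 : (k : ℝ) + 1 - p = k - (p - 1) := by ring
  rw [h4, Real.rpow_sub (hspos x), div_le_iff₀ (Real.rpow_pos_of_pos (hspos x) _)]
  rw [← h1] at h3
  linarith

end Extrema

/-! ### The gradient estimate. -/

section Gradient

variable {n k : ℕ} {s f : Sph n → ℝ} {p γ m M : ℝ}

/-- The squared norm of the gradient of the homogeneous extension; on the sphere this is
`s² + |∇ s|²`. -/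
noncomputable def gradSq (s : Sph n → ℝ) (y : Amb n) : ℝ :=
  ∑ a, dd (EuclideanSpace.basisFun (Fin (n + 1)) ℝ a) (homExt s) y *
    dd (EuclideanSpace.basisFun (Fin (n + 1)) ℝ a) (homExt s) y

theorem exists_gradient (s : Sph n → ℝ) (y : Amb n) :
    ∃ w : Amb n, w = ∑ a, dd (EuclideanSpace.basisFun (Fin (n + 1)) ℝ a) (homExt s) y •
        EuclideanSpace.basisFun (Fin (n + 1)) ℝ a ∧
      (∀ v, inner ℝ v w = dd v (homExt s) y) ∧ gradSq s y = ‖w‖ ^ 2 := by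
  refine ⟨_, rfl, ?_⟩
  set b := EuclideanSpace.basisFun (Fin (n + 1)) ℝ
  have h1 : ∀ v, inner ℝ v (∑ a, dd (b a) (homExt s) y • b a) = dd v (homExt s) y := by
    intro v
    conv_rhs => rw [← b.sum_repr' v]
    rw [dd_sum_left, inner_sum]
    refine Finset.sum_congr rfl fun a _ => ?_
    rw [real_inner_smul_right, real_inner_comm, mul_comm]
  refine ⟨h1, ?_⟩
  rw [← real_inner_self_eq_norm_sq, h1, dd_sum_left]
  rfl

theorem gradSq_smul (s : Sph n → ℝ) {c : ℝ} (hc : 0 < c) {y : Amb n} (hy : y ≠ 0) :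
    gradSq s (c • y) = gradSq s y := by
  unfold gradSq
  refine Finset.sum_congr rfl fun a _ => ?_
  rw [(posHomog_homExt s).dd _ c hc y hy]
  simp

theorem sq_le_gradSq (hs : ContMDiff (𝓡 n) 𝓘(ℝ, ℝ) 4 s) (x : Sph n) {v : Amb n}
    (hv : ‖v‖ = 1) (hxv : inner ℝ (x : Amb n) v = 0) :
    s x ^ 2 + dd v (homExt s) x ^ 2 ≤ gradSq s x := by
  obtain ⟨w, -, hw, hN⟩ := exists_gradient s (x : Amb n)
  have h1 : inner ℝ (x : Amb n) w = s x := by rw [hw, dd_self_homExt hs x.ne_zero, homExt_coe]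
  have h2 := hw v
  have hxx : inner ℝ (x : Amb n) (x : Amb n) = 1 := by
    rw [real_inner_self_eq_norm_sq, x.norm_eq, one_pow]
  have hvv : inner ℝ v v = 1 := by rw [real_inner_self_eq_norm_sq, hv, one_pow]
  have h3 : 0 ≤ ‖w - (s x • (x : Amb n) + dd v (homExt s) x • v)‖ ^ 2 := sq_nonneg _
  rw [← real_inner_self_eq_norm_sq] at h3 hN
  rw [hN]
  have hvx : inner ℝ v (x : Amb n) = 0 := by rw [real_inner_comm, hxv]
  have h1' : inner ℝ w (x : Amb n) = s x := by rw [real_inner_comm, h1]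
  have h2' : inner ℝ w v = dd v (homExt s) x := by rw [real_inner_comm, h2]
  simp only [inner_sub_left, inner_sub_right, inner_add_left, inner_add_right,
    real_inner_smul_left, real_inner_smul_right, hxx, hvv, hvx, hxv, h1, h2, h1', h2'] at h3
  linarith

/-- The two-jet of the squared gradient in an eigendirection. -/
theorem IsEigenframe.hasJet_gradSq (hs : ContMDiff (𝓡 n) 𝓘(ℝ, ℝ) 4 s) {x : Sph n}
    {e : Fin n → Amb n} {l : Fin n → ℝ} (hF : IsEigenframe s x e l) (i : Fin n) :
    HasJet (fun t => gradSq s (x + t • e i)) (gradSq s x) (2 * l i * dd (e i) (homExt s) x)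
      (2 * l i ^ 2 + 2 * ((∑ j, dd (e j) (homExt s) x *
        dd (e j) (dd (e i) (dd (e i) (homExt s))) x) - s x * l i)) := by
  have hx0 := x.ne_zero
  obtain ⟨w, hwdef, hw, -⟩ := exists_gradient s (x : Amb n)
  set b := EuclideanSpace.basisFun (Fin (n + 1)) ℝ with hb
  have J : ∀ a, _ := fun a => hasJet_line isOpen_punctured
    ((contDiffOn_dd_homExt hs (b a)).of_le (by norm_num)) hx0 (e i)
  have J2 := HasJet.sum Finset.univ fun a _ => (J a).mul (J a)
  have hwexp : w = s x • (x : Amb n) + ∑ j, dd (e j) (homExt s) x • e j := by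
    rw [hF.expand w, hw, dd_self_homExt hs hx0, homExt_coe]
    simp_rw [hw]
  have h1 : ∀ a, dd (e i) (dd (b a) (homExt s)) x = l i * inner ℝ (e i) (b a) := fun a => by
    rw [dd_dd_homExt_comm hs _ _ hx0, hF.hess]
  -- Ambient third derivatives commute, so the derivative of the gradient becomes the gradient of a
  -- second derivative, which the differentiated equation controls.
  have h2 : ∀ a, dd (e i) (dd (e i) (dd (b a) (homExt s))) x =
      dd (b a) (dd (e i) (dd (e i) (homExt s))) x := fun a => by
    rw [dd_congr_of_eqOn isOpen_punctured
      (dd_comm (contDiffOn_homExt_two hs) isOpen_punctured (e i) (b a)) (e i) hx0]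
    exact dd_comm ((contDiffOn_dd_homExt hs (e i)).of_le (by norm_num)) isOpen_punctured _ _ hx0
  have h3 : ∀ g : Amb n → ℝ, ∑ a, dd (b a) (homExt s) x * dd (b a) g x = dd w g x := fun g => by
    rw [hwdef, dd_sum_left]
  have h4 : ∑ a, l i * inner ℝ (e i) (b a) * dd (b a) (homExt s) x =
      l i * dd (e i) (homExt s) x := by
    rw [← hw, hwdef, inner_sum, Finset.mul_sum]
    refine Finset.sum_congr rfl fun a _ => ?_
    rw [real_inner_smul_right]; ring
  have h5 : ∑ a, (l i * inner ℝ (e i) (b a)) * (l i * inner ℝ (e i) (b a)) = l i ^ 2 := by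
    have := b.sum_sq_norm_inner_left (e i)
    simp only [Real.norm_eq_abs, sq_abs, hF.orthonormal.norm_eq_one, one_pow] at this
    calc _ = l i ^ 2 * ∑ a, inner ℝ (e i) (b a) ^ 2 := by
          rw [Finset.mul_sum]; exact Finset.sum_congr rfl fun a _ => by ring
      _ = l i ^ 2 := by rw [this, mul_one]
  -- The radial part `s x • x` of the ambient gradient produces `-s l_i`, because second derivatives
  -- have degree `-1`.
  have h6 : dd w (dd (e i) (dd (e i) (homExt s))) x = (∑ j, dd (e j) (homExt s) x *
      dd (e j) (dd (e i) (dd (e i) (homExt s))) x) - s x * l i := by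
    rw [hwexp, dd_add_left, dd_smul_left, dd_sum_left, dd_self_dd_dd_homExt hs _ _ hx0,
      hF.dd_dd_self]
    ring
  have J3 : HasJet (fun t => gradSq s (x + t • e i)) (gradSq s x) _ _ := J2
  convert J3 using 1
  · have : ∀ a, dd (e i) (dd (b a) (homExt s)) x * dd (b a) (homExt s) x +
        dd (b a) (homExt s) x * dd (e i) (dd (b a) (homExt s)) x =
        2 * (l i * inner ℝ (e i) (b a) * dd (b a) (homExt s) x) := fun a => by rw [h1]; ring
    refine Eq.trans ?_ (Finset.sum_congr rfl fun a _ => (this a).symm)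
    rw [← Finset.mul_sum, h4]; ring
  · have : ∀ a, dd (e i) (dd (e i) (dd (b a) (homExt s))) x * dd (b a) (homExt s) x +
        2 * (dd (e i) (dd (b a) (homExt s)) x * dd (e i) (dd (b a) (homExt s)) x) +
        dd (b a) (homExt s) x * dd (e i) (dd (e i) (dd (b a) (homExt s))) x =
        2 * ((l i * inner ℝ (e i) (b a)) * (l i * inner ℝ (e i) (b a))) +
        2 * (dd (b a) (homExt s) x * dd (b a) (dd (e i) (dd (e i) (homExt s))) x) :=
      fun a => by rw [h1, h2]; ring
    refine Eq.trans ?_ (Finset.sum_congr rfl fun a _ => (this a).symm)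
    rw [Finset.sum_add_distrib, ← Finset.mul_sum, ← Finset.mul_sum, h5, h3, h6]

/-- The maximum principle in one eigendirection, with `N = s² + |∇s|²`, eigenvalue `l` and gradient
component `g`. The critical point equation forces `g = 0` or `l = γN/(2σ)`. In either case `2l²`
dominates the unfavourable terms, in the second one because `γ < 2`, and only terms linear in `l`
remain. -/
theorem gradient_test_inequality {N l g S σ : ℝ} (hσ : 0 < σ) (hN : σ ^ 2 + g ^ 2 ≤ N)
    (hγ : 0 < γ) (hγ2 : γ < 2) (h1 : 2 * l * g / N - γ * (g / σ) = 0)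
    (h2 : (2 * l ^ 2 + 2 * (S - σ * l)) / N - (2 * l * g / N) ^ 2 -
      γ * (l / σ - (g / σ) ^ 2 - 1) ≤ 0) :
    2 * S ≤ (2 * σ + γ * N / σ) * l := by
  have hN0 : 0 < N := by nlinarith [sq_nonneg g]
  have h3 : 2 * l * g / N = γ * (g / σ) := by linarith
  rw [h3] at h2
  have h4 : 2 * l ^ 2 + 2 * (S - σ * l) ≤
      N * ((γ * (g / σ)) ^ 2 + γ * (l / σ - (g / σ) ^ 2 - 1)) := by
    rw [← div_le_iff₀' hN0]; linarith
  have h5 : γ * N / σ * l = N * (γ * (l / σ)) := by ring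
  have h6 : N * ((γ * (g / σ)) ^ 2 - γ * (g / σ) ^ 2 - γ) ≤ 2 * l ^ 2 := by
    by_cases hg : g = 0
    · subst hg; simp; nlinarith [sq_nonneg l, mul_pos hN0 hγ]
    · have h7 : l = γ * N / (2 * σ) := by
        field_simp at h3 ⊢
        linarith
      have h8 : 2 * l ^ 2 = N * (γ ^ 2 * N / (2 * σ ^ 2)) := by rw [h7]; field_simp
      rw [h8]
      refine mul_le_mul_of_nonneg_left ?_ hN0.le
      have h9 : (γ * (g / σ)) ^ 2 - γ * (g / σ) ^ 2 - γ =
          (2 * (γ ^ 2 * g ^ 2 - γ * g ^ 2 - γ * σ ^ 2)) / (2 * σ ^ 2) := by field_simp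
      rw [h9]
      refine div_le_div_of_nonneg_right ?_ (by positivity)
      have : γ ^ 2 * (σ ^ 2 + g ^ 2) ≤ γ ^ 2 * N := mul_le_mul_of_nonneg_left hN (sq_nonneg _)
      nlinarith [mul_nonneg (mul_nonneg hγ.le (sub_pos.2 hγ2).le) (sq_nonneg g),
        mul_pos hγ (pow_pos hσ 2), mul_nonneg (sq_nonneg γ) (sq_nonneg σ)]
  nlinarith

/-- At a maximum of `(s² + |∇ s|²) / s ^ γ`, the gradient is controlled by `s`. -/
theorem gradSq_le_at_max (hs : ContMDiff (𝓡 n) 𝓘(ℝ, ℝ) 4 s)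
    (hf : ContMDiff (𝓡 n) 𝓘(ℝ, ℝ) 2 f) (ht : TauPos s) (hk : k ≤ n)
    (hspos : ∀ x, 0 < s x) (hsol : SolvesEq k p f s) (hm : 0 < m) (hfm : ∀ x, m ≤ f x)
    (hM : c2Norm f ≤ M) (hγ : 0 < γ) (hγ2 : γ < 2) (hγp : γ * k < 2 * (p - 1)) {x : Sph n}
    (hmax : ∀ z : Sph n, Real.log (gradSq s z) - γ * Real.log (s z) ≤
      Real.log (gradSq s x) - γ * Real.log (s x)) :
    gradSq s x ≤
      (1 + ((2 * (M / m) + (2 + γ) * k) / (2 * (p - 1) - γ * k) + 1) ^ 2) * s x ^ 2 := by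
  obtain ⟨e, l, hF⟩ := exists_isEigenframe hs ht x
  have hx0 := x.ne_zero
  have hfpos : ∀ x, 0 < f x := fun x => hm.trans_le (hfm x)
  have hk' : k ≤ Fintype.card (Fin n) := by simpa using hk
  set g : Fin n → ℝ := fun i => dd (e i) (homExt s) x with hg
  set σ := s x with hσdef
  have hσ : 0 < σ := hspos x
  set N := gradSq s x with hNdef
  have hNi : ∀ i, σ ^ 2 + g i ^ 2 ≤ N := fun i =>
    sq_le_gradSq hs x (hF.orthonormal.norm_eq_one i) (hF.inner_base i)
  obtain ⟨w, -, hw, hNw⟩ := exists_gradient s (x : Amb n)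
  have hwexp : w = σ • (x : Amb n) + ∑ j, g j • e j := by
    rw [hF.expand w, hw, dd_self_homExt hs hx0, homExt_coe]
    simp_rw [hw]; rfl
  set T : Amb n := ∑ j, g j • e j with hT
  set G := ‖T‖ with hG
  have hxT : inner ℝ (x : Amb n) T = 0 := by
    rw [hT, inner_sum]
    exact Finset.sum_eq_zero fun j _ => by rw [real_inner_smul_right, hF.inner_base, mul_zero]
  have hNG : N = σ ^ 2 + G ^ 2 := by
    rw [hNdef, hNw, hwexp, norm_add_sq_real, real_inner_smul_left, hxT, norm_smul, x.norm_eq]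
    simp [hG]
  have hGsum : G ^ 2 = ∑ j, g j ^ 2 := by
    rw [hG, ← real_inner_self_eq_norm_sq, hT, hF.orthonormal.inner_sum]
    exact Finset.sum_congr rfl fun j _ => by simp [sq]
  have hN0 : 0 < N := by rw [hNG]; positivity
  set S : Fin n → ℝ := fun i => ∑ j, g j * dd (e j) (dd (e i) (dd (e i) (homExt s))) x with hS
  have hi : ∀ i, 2 * S i ≤ (2 * σ + γ * N / σ) * l i := by
    intro i
    have J := ((hF.hasJet_gradSq hs i).log hN0.ne').add
      ((hF.hasJet_log hs hspos i).const_mul (-γ))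
    obtain ⟨h1, h2⟩ := J.of_isLocalMax <| Filter.Eventually.of_forall fun t => by
      have h3 := hmax (toSph (x + t • e i) (hF.line_ne_zero i t))
      have h4 : gradSq s (toSph ((x : Amb n) + t • e i) (hF.line_ne_zero i t)) =
          gradSq s (x + t • e i) :=
        gradSq_smul s (inv_pos.2 (norm_pos_iff.2 (hF.line_ne_zero i t))) (hF.line_ne_zero i t)
      rw [h4] at h3
      simp only [toSph_line_zero]
      simp only [zero_smul, add_zero, ← hNdef, ← hσdef]
      linarith
    simp only [← hNdef, ← hσdef] at h1 h2
    refine gradient_test_inequality hσ (hNi i) hγ hγ2 (by linarith) (by linarith)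
  have hw0 : ∀ i, 0 ≤ invWeight k l i := invWeight_nonneg hk' hF.pos
  -- As the bound is linear in `l i`, Euler's identity evaluates its weighted sum.
  have hsum : ∑ i, invWeight k l i * (2 * S i) ≤ (2 * σ + γ * N / σ) * k := by
    rw [← sum_invWeight_mul_self hk' hF.pos, Finset.mul_sum]
    refine Finset.sum_le_sum fun i _ => ?_
    calc _ ≤ invWeight k l i * ((2 * σ + γ * N / σ) * l i) :=
          mul_le_mul_of_nonneg_left (hi i) (hw0 i)
      _ = _ := by ring
  -- The left side is the once differentiated equation contracted with the tangential gradient `T`.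
  have hlhs : ∑ i, invWeight k l i * (2 * S i) =
      2 * ((p - 1) / σ * G ^ 2 + dd T (radialExt f) x / f x) := by
    have h1 : ∑ i, invWeight k l i * (2 * S i) = 2 * ∑ j, g j * ∑ i, invWeight k l i *
        dd (e j) (dd (e i) (dd (e i) (homExt s))) x := by
      simp_rw [hS, Finset.mul_sum]
      rw [Finset.sum_comm]
      exact Finset.sum_congr rfl fun j _ => Finset.sum_congr rfl fun i _ => by ring
    rw [h1]
    congr 1
    rw [hGsum, hT, dd_sum_left, Finset.mul_sum, Finset.sum_div, ← Finset.sum_add_distrib]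
    refine Finset.sum_congr rfl fun j _ => ?_
    rw [← (hF.derivatives hs hf ht hk hspos hfpos hsol j).1]
    simp only [hg]
    ring
  rw [hlhs] at hsum
  have hfT : -(M / m * G) ≤ dd T (radialExt f) x / f x := by
    have h1 := abs_dd_radialExt_le hf hM x T
    have h2 : |dd T (radialExt f) x / f x| ≤ M * G / m := by
      rw [abs_div, abs_of_pos (hfpos x)]
      exact div_le_div₀ ((abs_nonneg _).trans h1) h1 hm (hfm x)
    have h3 := (abs_le.1 h2).1
    linarith [show M * G / m = M / m * G by ring]
  have hM0 : 0 ≤ M / m := by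
    have := (c2Norm_bounds hf hM x).1
    exact div_nonneg ((abs_nonneg _).trans this) hm.le
  set d := 2 * (p - 1) - γ * k with hd
  have hd0 : 0 < d := by rw [hd]; linarith
  have hG0 : 0 ≤ G := norm_nonneg _
  -- After multiplication by `σ` and substitution of `N = σ² + G²`, the hypothesis on `γ` leaves the
  -- positive coefficient `d = 2(p-1) - γk` on `G²`.
  have hkey : d * G ^ 2 ≤ 2 * σ * (M / m) * G + (2 + γ) * k * σ ^ 2 := by
    have h1 : 2 * ((p - 1) / σ * G ^ 2 - M / m * G) ≤ (2 * σ + γ * N / σ) * k := by linarith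
    have h2 := mul_le_mul_of_nonneg_left h1 hσ.le
    have h3 : σ * (2 * ((p - 1) / σ * G ^ 2 - M / m * G)) =
        2 * ((p - 1) * G ^ 2 - σ * (M / m) * G) := by field_simp
    have h4 : σ * ((2 * σ + γ * N / σ) * k) = (2 * σ ^ 2 + γ * N) * k := by field_simp
    rw [h3, h4, hNG] at h2
    rw [hd]; linarith
  set B := 2 * (M / m) + (2 + γ) * k with hB
  have hB0 : 0 ≤ B := by positivity
  have hGle : G ≤ (B / d + 1) * σ := by
    by_cases h : G ≤ σ
    · have : 0 ≤ B / d * σ := by positivity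
      linarith
    · push Not at h
      have h1 : d * G ^ 2 ≤ B * σ * G := by
        have : (2 + γ) * k * σ ^ 2 ≤ (2 + γ) * k * (σ * G) := by
          refine mul_le_mul_of_nonneg_left ?_ (by positivity)
          rw [sq]; exact mul_le_mul_of_nonneg_left h.le hσ.le
        rw [hB]; linarith
      have hGpos : 0 < G := hσ.trans h
      have h2 : d * G ≤ B * σ := by
        refine le_of_mul_le_mul_right ?_ hGpos
        linarith [show d * G ^ 2 = d * G * G by ring]
      have h3 : G ≤ B / d * σ := by
        rw [div_mul_eq_mul_div, le_div_iff₀ hd0]; linarith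
      linarith
  have hGsq : G ^ 2 ≤ ((B / d + 1) * σ) ^ 2 := pow_le_pow_left₀ hG0 hGle 2
  rw [hNG]
  linarith [mul_pow (B / d + 1) σ 2]

theorem continuous_gradSq (hs : ContMDiff (𝓡 n) 𝓘(ℝ, ℝ) 4 s) :
    Continuous fun x : Sph n => gradSq s x := by
  have h : ∀ a, Continuous fun x : Sph n => dd a (homExt s) (x : Amb n) := fun a =>
    (contDiffOn_dd_homExt hs a).continuousOn.comp_continuous continuous_subtype_val
      fun x => x.ne_zero
  exact continuous_finsetSum _ fun a _ => (h _).mul (h _)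

/-- The gradient estimate. -/
theorem gradSq_le (hn : 1 ≤ n) (hs : ContMDiff (𝓡 n) 𝓘(ℝ, ℝ) 4 s)
    (hf : ContMDiff (𝓡 n) 𝓘(ℝ, ℝ) 2 f) (ht : TauPos s) (hk : k ≤ n)
    (hspos : ∀ x, 0 < s x) (hsol : SolvesEq k p f s) (hm : 0 < m) (hfm : ∀ x, m ≤ f x)
    (hM : c2Norm f ≤ M) (hγ : 0 < γ) (hγ2 : γ < 2) (hγp : γ * k < 2 * (p - 1)) {R : ℝ}
    (hR : ∀ x, s x ≤ R) (z : Sph n) :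
    gradSq s z ≤ (1 + ((2 * (M / m) + (2 + γ) * k) / (2 * (p - 1) - γ * k) + 1) ^ 2) *
      R ^ (2 - γ) * s z ^ γ := by
  have hNpos : ∀ x : Sph n, 0 < gradSq s x := fun x => by
    obtain ⟨v, hv, hxv⟩ := exists_unit_orthogonal hn x
    have := sq_le_gradSq hs x hv hxv
    have := pow_pos (hspos x) 2
    nlinarith [sq_nonneg (dd v (homExt s) x)]
  have hcont : Continuous fun z : Sph n => Real.log (gradSq s z) - γ * Real.log (s z) :=
    ((continuous_gradSq hs).log fun x => (hNpos x).ne').sub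
      (continuous_const.mul (hs.continuous.log fun x => (hspos x).ne'))
  obtain ⟨x, -, hx⟩ := isCompact_univ.exists_isMaxOn (⟨z, Set.mem_univ z⟩ : Set.univ.Nonempty)
    hcont.continuousOn
  have hmax : ∀ z : Sph n, Real.log (gradSq s z) - γ * Real.log (s z) ≤
      Real.log (gradSq s x) - γ * Real.log (s x) := fun z => hx (Set.mem_univ z)
  have h1 := gradSq_le_at_max hs hf ht hk hspos hsol hm hfm hM hγ hγ2 hγp hmax
  set A := 1 + ((2 * (M / m) + (2 + γ) * k) / (2 * (p - 1) - γ * k) + 1) ^ 2 with hA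
  have hA0 : 0 < A := by positivity
  have h2 : ∀ z : Sph n, Real.exp (Real.log (gradSq s z) - γ * Real.log (s z)) =
      gradSq s z / s z ^ γ := fun z => by
    rw [Real.exp_sub, Real.exp_log (hNpos z), mul_comm, ← Real.rpow_def_of_pos (hspos z)]
  have h3 := Real.exp_le_exp.2 (hmax z)
  rw [h2, h2, div_le_iff₀ (Real.rpow_pos_of_pos (hspos z) _)] at h3
  refine h3.trans (mul_le_mul_of_nonneg_right ?_ (Real.rpow_nonneg (hspos z).le _))
  have h4 : s x ^ 2 / s x ^ γ = s x ^ (2 - γ) := by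
    rw [Real.rpow_sub (hspos x)]; norm_cast
  calc gradSq s x / s x ^ γ ≤ A * s x ^ 2 / s x ^ γ :=
        div_le_div_of_nonneg_right h1 (Real.rpow_nonneg (hspos x).le _)
    _ = A * s x ^ (2 - γ) := by rw [mul_div_assoc, h4]
    _ ≤ A * R ^ (2 - γ) := mul_le_mul_of_nonneg_left
        (Real.rpow_le_rpow (hspos x).le (hR x) (by linarith)) hA0.le

end Gradient

/-! ### Comparing the minimum with the maximum. -/

section Harnack

variable {n : ℕ} {s : Sph n → ℝ}

theorem greatCircle_norm {x v : Amb n} (hx : ‖x‖ = 1) (hv : ‖v‖ = 1) (hxv : inner ℝ x v = 0)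
    (t : ℝ) : ‖Real.cos t • x + Real.sin t • v‖ = 1 := by
  rw [← sq_eq_sq₀ (norm_nonneg _) zero_le_one, norm_add_sq_real, norm_smul, norm_smul, hx, hv,
    real_inner_smul_left, real_inner_smul_right, hxv]
  simp

theorem hasDerivAt_greatCircle (x v : Amb n) (t : ℝ) :
    HasDerivAt (fun t => Real.cos t • x + Real.sin t • v)
      (-Real.sin t • x + Real.cos t • v) t :=
  ((Real.hasDerivAt_cos t).smul_const x).add ((Real.hasDerivAt_sin t).smul_const v)

theorem dd_homExt_eq_zero_of_isMax (hs : ContMDiff (𝓡 n) 𝓘(ℝ, ℝ) 4 s) {x : Sph n}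
    (hmax : ∀ z, s z ≤ s x) {v : Amb n} (hv : ‖v‖ = 1) (hxv : inner ℝ (x : Amb n) v = 0) :
    dd v (homExt s) x = 0 := by
  have h0 : Real.cos 0 • (x : Amb n) + Real.sin 0 • v = x := by simp
  have h := hasDerivAt_dd_curve (g := homExt s) (hasDerivAt_greatCircle (x : Amb n) v 0)
    (by rw [h0]; exact (contDiffOn_homExt hs).differentiableAt_punctured (by norm_num) x.ne_zero)
  have hloc : IsLocalMax (fun t => homExt s (Real.cos t • (x : Amb n) + Real.sin t • v)) 0 := by
    refine Filter.Eventually.of_forall fun t => ?_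
    simp only [h0]
    let z : Sph n := ⟨Real.cos t • (x : Amb n) + Real.sin t • v,
      by simpa using greatCircle_norm x.norm_eq hv hxv t⟩
    change homExt s (z : Amb n) ≤ _
    rw [homExt_coe, homExt_coe]
    exact hmax z
  have h1 := hloc.hasDerivAt_eq_zero h
  rw [h0] at h1
  simpa using h1

/-- A support function dominates the support function of the segment to the farthest point. -/
theorem mul_inner_le (hn : 1 ≤ n) (hs : ContMDiff (𝓡 n) 𝓘(ℝ, ℝ) 4 s) (ht : TauPos s) {x : Sph n}
    (hmax : ∀ z, s z ≤ s x) (z : Sph n) : s x * inner ℝ (z : Amb n) (x : Amb n) ≤ s z := by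
  obtain ⟨v, hv, hxv, t, ⟨ht0, htπ⟩, hz⟩ := exists_greatCircle hn x z
  have hvx : inner ℝ v (x : Amb n) = 0 := by rw [real_inner_comm, hxv]
  have hzx : inner ℝ (z : Amb n) (x : Amb n) = Real.cos t := by
    rw [hz, inner_add_left, real_inner_smul_left, real_inner_smul_left, hvx,
      real_inner_self_eq_norm_sq, x.norm_eq]
    simp
  rcases ht0.eq_or_lt with rfl | ht0
  · have : z = x := Subtype.ext (by rw [hz]; simp)
    rw [this, real_inner_self_eq_norm_sq, x.norm_eq]; simp
  · have h := lt_apply_greatCircle hs ht x.norm_eq hv hxv ht0 htπ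
    rw [← hz, dd_homExt_eq_zero_of_isMax hs hmax hv hxv, homExt_coe, homExt_coe] at h
    rw [hzx]; linarith

/-- Integrating the gradient estimate along a great circle. -/
theorem rpow_greatCircle_le (hs : ContMDiff (𝓡 n) 𝓘(ℝ, ℝ) 4 s) (hspos : ∀ x, 0 < s x)
    {A γ R : ℝ} (hA : 0 ≤ A) (hγ : 0 < γ) (hγ2 : γ < 2) (hR : 0 < R)
    (hgrad : ∀ z : Sph n, gradSq s z ≤ A * R ^ (2 - γ) * s z ^ γ) (x : Sph n) {v : Amb n}
    (hv : ‖v‖ = 1) (hxv : inner ℝ (x : Amb n) v = 0) {t : ℝ} (ht : 0 ≤ t) :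
    homExt s (Real.cos t • (x : Amb n) + Real.sin t • v) ^ (1 - γ / 2) ≤
      s x ^ (1 - γ / 2) + √A * R ^ (1 - γ / 2) * t := by
  -- The gradient bound reads `|∇s| ≤ √A R^β s^(1-β)`, so this power makes `s ^ β` Lipschitz along
  -- unit-speed circles.
  set β := 1 - γ / 2 with hβ
  have hβ0 : 0 < β := by rw [hβ]; linarith
  have hβ1 : β ≤ 1 := by rw [hβ]; linarith
  set c : ℝ → Amb n := fun t => Real.cos t • (x : Amb n) + Real.sin t • v with hc
  let z : ℝ → Sph n := fun t => ⟨c t, by simpa using greatCircle_norm x.norm_eq hv hxv t⟩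
  set c' : ℝ → Amb n := fun t => -Real.sin t • (x : Amb n) + Real.cos t • v with hc'
  have hvx : inner ℝ v (x : Amb n) = 0 := by rw [real_inner_comm, hxv]
  have hxx : inner ℝ (x : Amb n) (x : Amb n) = 1 := by
    rw [real_inner_self_eq_norm_sq, x.norm_eq, one_pow]
  have hvv : inner ℝ v v = 1 := by rw [real_inner_self_eq_norm_sq, hv, one_pow]
  have hc1 : ∀ r, ‖c' r‖ = 1 := fun r => by
    rw [← sq_eq_sq₀ (norm_nonneg _) zero_le_one, ← real_inner_self_eq_norm_sq]
    simp only [hc', inner_add_left, inner_add_right, real_inner_smul_left, real_inner_smul_right,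
      hxx, hvv, hxv, hvx]
    linear_combination Real.cos_sq_add_sin_sq r
  have horth : ∀ r, inner ℝ (z r : Amb n) (c' r) = 0 := fun r => by
    simp only [z, hc, hc', inner_add_left, inner_add_right, real_inner_smul_left,
      real_inner_smul_right, hxx, hvv, hxv, hvx]
    ring
  have hzc : ∀ r, homExt s (c r) = s (z r) := fun r => homExt_coe s (z r)
  have hpos : ∀ r, 0 < homExt s (c r) := fun r => by rw [hzc]; exact hspos _
  have hd : ∀ r, HasDerivAt (fun r => homExt s (c r) ^ β)
      (dd (c' r) (homExt s) (c r) * β * homExt s (c r) ^ (β - 1)) r := fun r => by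
    refine HasDerivAt.rpow_const ?_ (Or.inl (hpos r).ne')
    exact hasDerivAt_dd_curve (hasDerivAt_greatCircle _ _ r)
      ((contDiffOn_homExt hs).differentiableAt_punctured (by norm_num) (z r).ne_zero)
  have hbound : ∀ r, dd (c' r) (homExt s) (c r) * β * homExt s (c r) ^ (β - 1) ≤
      √A * R ^ β := by
    intro r
    set φ := homExt s (c r) with hφ
    set D := dd (c' r) (homExt s) (c r) with hD
    have h1 : D ^ 2 ≤ A * R ^ (2 - γ) * φ ^ γ := by
      have h2 := sq_le_gradSq hs (z r) (hc1 r) (horth r)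
      have h3 := hgrad (z r)
      rw [← hzc] at h3
      have : 0 ≤ s (z r) ^ 2 := sq_nonneg _
      exact le_trans (by linarith) (h2.trans h3)
    have h4 : A * R ^ (2 - γ) * φ ^ γ = (√A * R ^ β * φ ^ (1 - β)) ^ 2 := by
      have e1 : R ^ (2 - γ) = (R ^ β) ^ 2 := by
        rw [← Real.rpow_natCast, ← Real.rpow_mul hR.le]; congr 1; rw [hβ]; push_cast; ring
      have e2 : φ ^ γ = (φ ^ (1 - β)) ^ 2 := by
        rw [← Real.rpow_natCast, ← Real.rpow_mul (hpos r).le]; congr 1; rw [hβ]; push_cast; ring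
      rw [e1, e2, mul_pow, mul_pow, Real.sq_sqrt hA]
    have h5 : 0 ≤ √A * R ^ β * φ ^ (1 - β) :=
      mul_nonneg (mul_nonneg (Real.sqrt_nonneg _) (Real.rpow_nonneg hR.le _))
        (Real.rpow_nonneg (hpos r).le _)
    have h6 : |D| ≤ √A * R ^ β * φ ^ (1 - β) := abs_le_of_sq_le_sq (h1.trans h4.le) h5
    have h7 : φ ^ (1 - β) * φ ^ (β - 1) = 1 := by
      rw [← Real.rpow_add (hpos r)]; simp
    have h8 : 0 ≤ φ ^ (β - 1) := Real.rpow_nonneg (hpos r).le _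
    calc D * β * φ ^ (β - 1) ≤ |D| * 1 * φ ^ (β - 1) := by
          refine mul_le_mul_of_nonneg_right ?_ h8
          exact mul_le_mul (le_abs_self D) hβ1 hβ0.le (abs_nonneg D)
      _ ≤ √A * R ^ β * φ ^ (1 - β) * 1 * φ ^ (β - 1) := by gcongr
      _ = √A * R ^ β * (φ ^ (1 - β) * φ ^ (β - 1)) := by ring
      _ = √A * R ^ β := by rw [h7, mul_one]
  have hlin : AntitoneOn (fun r => homExt s (c r) ^ β - √A * R ^ β * r) (Set.Icc 0 t) := by
    have hd2 : ∀ r, HasDerivAt (fun r => homExt s (c r) ^ β - √A * R ^ β * r)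
        (dd (c' r) (homExt s) (c r) * β * homExt s (c r) ^ (β - 1) - √A * R ^ β) r := fun r => by
      exact ((hd r).sub ((hasDerivAt_id r).const_mul (√A * R ^ β))).congr_deriv (by simp)
    refine antitoneOn_of_deriv_nonpos (convex_Icc 0 t)
      (fun r _ => (hd2 r).continuousAt.continuousWithinAt)
      (fun r _ => (hd2 r).differentiableAt.differentiableWithinAt) fun r _ => ?_
    rw [(hd2 r).deriv]
    linarith [hbound r]
  have h := hlin ⟨le_rfl, ht⟩ ⟨ht, le_rfl⟩ ht
  have h0 : c 0 = x := by simp [hc]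
  simp only [h0, homExt_coe, mul_zero, sub_zero] at h
  linarith

/-- The gradient estimate bounds the ratio of the minimum and the maximum of an even support
function. -/
theorem exists_mul_max_le {A γ : ℝ} (hA : 1 ≤ A) (hγ : 0 < γ) (hγ2 : γ < 2) :
    ∃ c : ℝ, 0 < c ∧ ∀ (n : ℕ) (s : Sph n → ℝ), 1 ≤ n → ContMDiff (𝓡 n) 𝓘(ℝ, ℝ) 4 s →
      TauPos s → IsEven s → (∀ x, 0 < s x) → ∀ x₀ : Sph n, (∀ z, s z ≤ s x₀) →
      (∀ z : Sph n, gradSq s z ≤ A * s x₀ ^ (2 - γ) * s z ^ γ) → ∀ x, c * s x₀ ≤ s x := by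
  set β := 1 - γ / 2 with hβ
  have hβ0 : 0 < β := by rw [hβ]; linarith
  have hβ1 : 0 < 1 - β := by rw [hβ]; linarith
  set K := √A with hK
  have hK0 : 0 < K := Real.sqrt_pos.2 (by linarith)
  -- Small enough for `2Kt ≤ (t/4)^β`, which is possible because `β < 1`; the cap at `1` serves `sin
  -- t ≥ t/2` and `cos t ≥ 0`.
  set t : ℝ := min 1 (((1 / 4) ^ β / (2 * K)) ^ (1 / (1 - β))) with htdef
  have ht0 : 0 < t := lt_min one_pos (by positivity)
  have ht1 : t ≤ 1 := min_le_left _ _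
  have ht2 : 2 * K * t ≤ (t / 4) ^ β := by
    have h1 : t ^ (1 - β) ≤ (1 / 4) ^ β / (2 * K) := by
      calc t ^ (1 - β) ≤ (((1 / 4) ^ β / (2 * K)) ^ (1 / (1 - β))) ^ (1 - β) :=
            Real.rpow_le_rpow ht0.le (min_le_right _ _) hβ1.le
        _ = (1 / 4) ^ β / (2 * K) := by
            rw [← Real.rpow_mul (by positivity), one_div_mul_cancel hβ1.ne', Real.rpow_one]
    have h2 : t = t ^ (1 - β) * t ^ β := by
      rw [← Real.rpow_add ht0]; simp
    have h3 : (t / 4) ^ β = (1 / 4) ^ β * t ^ β := by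
      rw [← Real.mul_rpow (by norm_num) ht0.le]; congr 1; ring
    rw [le_div_iff₀ (by positivity)] at h1
    rw [h3]
    calc 2 * K * t = t ^ (1 - β) * (2 * K) * t ^ β := by conv_lhs => rw [h2]
                                                         ring
      _ ≤ _ := mul_le_mul_of_nonneg_right h1 (Real.rpow_nonneg ht0.le _)
  refine ⟨min (1 / 2) ((K * t) ^ (1 / β)), lt_min (by norm_num) (by positivity), ?_⟩
  intro n s hn hs ht he hspos x₀ hmax hgrad x
  have hR : 0 < s x₀ := hspos x₀
  -- By evenness `x₀` or `-x₀` can serve as the pole, whichever lies in the closed hemisphere of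
  -- `x`.
  obtain ⟨e, hle, hxe⟩ : ∃ e : Sph n, (∀ z : Sph n, s x₀ * inner ℝ (z : Amb n) (e : Amb n) ≤ s z) ∧
      0 ≤ inner ℝ (x : Amb n) (e : Amb n) := by
    rcases le_total 0 (inner ℝ (x : Amb n) (x₀ : Amb n)) with h | h
    · exact ⟨x₀, mul_inner_le hn hs ht hmax, h⟩
    · refine ⟨-x₀, fun z => ?_, by simpa using h⟩
      have := mul_inner_le hn hs ht hmax (-z)
      rw [he z] at this
      simpa using this
  obtain ⟨v, hv, hxv, α, ⟨hα0, hαπ⟩, hez⟩ := exists_greatCircle hn x e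
  have hxx : inner ℝ (x : Amb n) (x : Amb n) = 1 := by
    rw [real_inner_self_eq_norm_sq, x.norm_eq, one_pow]
  have hvv : inner ℝ v v = 1 := by rw [real_inner_self_eq_norm_sq, hv, one_pow]
  have hvx : inner ℝ v (x : Amb n) = 0 := by rw [real_inner_comm, hxv]
  have hcos : inner ℝ (x : Amb n) (e : Amb n) = Real.cos α := by
    rw [hez, inner_add_right, real_inner_smul_right, real_inner_smul_right, hxx, hxv]; simp
  rw [hcos] at hxe
  -- Far from the equator the linear lower bound suffices. Otherwise a step of length `t` towards
  -- the pole `e` reaches height at least `t/4`.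
  rcases le_total (1 / 2) (Real.cos α) with h | h
  · calc min (1 / 2) ((K * t) ^ (1 / β)) * s x₀ ≤ 1 / 2 * s x₀ := by gcongr; exact min_le_left _ _
      _ ≤ Real.cos α * s x₀ := by gcongr
      _ ≤ s x := by have := hle x; rw [hcos] at this; linarith
  · have hsin : 1 / 2 ≤ Real.sin α := by
      have h1 := Real.sin_nonneg_of_nonneg_of_le_pi hα0 hαπ
      nlinarith [Real.sin_sq_add_cos_sq α]
    have hsint : t / 2 ≤ Real.sin t := by
      have := Real.sin_gt_sub_cube ht0
      have : t ^ 3 ≤ t := pow_le_of_le_one ht0.le ht1 (by norm_num)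
      linarith
    have hcost : 0 ≤ Real.cos t :=
      Real.cos_nonneg_of_mem_Icc ⟨by linarith [Real.pi_pos], by linarith [Real.pi_gt_three]⟩
    let z : Sph n := ⟨Real.cos t • (x : Amb n) + Real.sin t • v,
      by simpa using greatCircle_norm x.norm_eq hv hxv t⟩
    have h1 : s x₀ * (t / 4) ≤ s z := by
      refine le_trans (mul_le_mul_of_nonneg_left ?_ hR.le) (hle z)
      have : inner ℝ (z : Amb n) (e : Amb n) =
          Real.cos t * Real.cos α + Real.sin t * Real.sin α := by
        simp only [z, hez, inner_add_left, inner_add_right, real_inner_smul_left,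
          real_inner_smul_right, hxx, hvv, hxv, hvx]
        ring
      rw [this]
      nlinarith [mul_nonneg hcost hxe]
    have h2 := rpow_greatCircle_le hs hspos (by linarith) hγ hγ2 hR hgrad x hv hxv ht0.le
    change homExt s (z : Amb n) ^ β ≤ s x ^ β + K * s x₀ ^ β * t at h2
    rw [homExt_coe] at h2
    have h3 : s x₀ ^ β * (t / 4) ^ β ≤ s z ^ β := by
      rw [← Real.mul_rpow hR.le (by positivity)]
      exact Real.rpow_le_rpow (by positivity) h1 hβ0.le
    have hRβ : 0 < s x₀ ^ β := Real.rpow_pos_of_pos hR _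
    -- Half of `(t/4)^β ≥ 2Kt` pays for the Lipschitz loss `Kt`; the other half survives.
    have h4 : K * t * s x₀ ^ β ≤ s x ^ β := by
      have := mul_le_mul_of_nonneg_left ht2 hRβ.le
      linarith
    have h5 : ((K * t) ^ (1 / β) * s x₀) ^ β ≤ s x ^ β := by
      rw [Real.mul_rpow (by positivity) hR.le, ← Real.rpow_mul (by positivity),
        one_div_mul_cancel hβ0.ne', Real.rpow_one]
      exact h4
    have h6 := (Real.rpow_le_rpow_iff (by positivity) (hspos x).le hβ0).1 h5
    refine le_trans ?_ h6
    gcongr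
    exact min_le_right _ _

end Harnack

/-! ### The bound for the largest eigenvalue. -/

section SecondOrder

variable {n k : ℕ} {s f : Sph n → ℝ} {p m M : ℝ}

theorem dd_dd_dd_comm {E : Type*} [NormedAddCommGroup E] [NormedSpace ℝ E] {g : E → ℝ}
    {U : Set E} (hg : ContDiffOn ℝ 3 g U) (hU : IsOpen U) (v w : E) :
    Set.EqOn (dd v (dd w (dd w g))) (dd w (dd w (dd v g))) U :=
  (dd_comm (ContDiffOn.dd (m := 2) hg hU w) hU v w).trans
    (dd_congr_of_eqOn hU (dd_comm (hg.of_le (by norm_num)) hU v w) w)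

theorem dd_dd_dd_dd_homExt_comm (hs : ContMDiff (𝓡 n) 𝓘(ℝ, ℝ) 4 s) (v w : Amb n) {y : Amb n}
    (hy : y ≠ 0) : dd v (dd v (dd w (dd w (homExt s)))) y =
      dd w (dd w (dd v (dd v (homExt s)))) y := by
  rw [dd_congr_of_eqOn isOpen_punctured (dd_dd_dd_comm ((contDiffOn_homExt hs).of_le (by norm_num))
    isOpen_punctured v w) v hy]
  exact dd_dd_dd_comm (contDiffOn_dd_homExt hs v) isOpen_punctured v w hy

theorem nonempty_sph (n : ℕ) : Nonempty (Sph n) := by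
  have : Nontrivial (Amb n) := Module.nontrivial_of_finrank_pos (R := ℝ)
    (by rw [finrank_euclideanSpace_fin]; omega)
  obtain ⟨v, hv⟩ := exists_norm_eq (Amb n) zero_le_one
  exact ⟨⟨v, by simpa using hv⟩⟩

/-- Compactness of pairs of unit vectors. The direction ranges over all ambient unit vectors, and
scaling by `‖y‖` and `‖u‖` extends the bound off the sphere, so it applies along straight lines
without adjusting frames. -/
theorem exists_max_hess (hs : ContMDiff (𝓡 n) 𝓘(ℝ, ℝ) 4 s) :
    ∃ x₀ u₀ : Sph n, ∀ (y : Amb n), y ≠ 0 → ∀ u : Amb n, ‖y‖ * dd u (dd u (homExt s)) y ≤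
      dd (u₀ : Amb n) (dd (u₀ : Amb n) (homExt s)) x₀ * ‖u‖ ^ 2 := by
  have hne := nonempty_sph n
  have h2 := contDiffOn_homExt_two hs
  have hc1 : ContinuousOn (fderiv ℝ (fderiv ℝ (homExt s))) ({0}ᶜ : Set (Amb n)) :=
    ((h2.fderiv_of_isOpen isOpen_punctured (m := 1) (by norm_num)).fderiv_of_isOpen
      isOpen_punctured (m := 0) (by norm_num)).continuousOn
  have hc2 : Continuous fun q : Sph n × Sph n =>
      dd (q.2 : Amb n) (dd (q.2 : Amb n) (homExt s)) q.1 := by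
    have h3 : Continuous fun q : Sph n × Sph n =>
        fderiv ℝ (fderiv ℝ (homExt s)) (q.1 : Amb n) (q.2 : Amb n) (q.2 : Amb n) :=
      ((hc1.comp_continuous (continuous_subtype_val.comp continuous_fst)
        fun q => Sph.ne_zero q.1).clm_apply (continuous_subtype_val.comp continuous_snd)).clm_apply
        (continuous_subtype_val.comp continuous_snd)
    convert h3 using 2 with q
    exact dd_dd_eq_fderiv h2 isOpen_punctured (Sph.ne_zero q.1) _ _
  obtain ⟨⟨x₀, u₀⟩, -, hmax⟩ := isCompact_univ.exists_isMaxOn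
    (Set.univ_nonempty (α := Sph n × Sph n)) hc2.continuousOn
  refine ⟨x₀, u₀, fun y hy u => ?_⟩
  by_cases hu : u = 0
  · subst hu; simp [dd_zero_left]
  · have h3 : dd (toSph u hu : Amb n) (dd (toSph u hu : Amb n) (homExt s)) (toSph y hy) ≤
        dd (u₀ : Amb n) (dd (u₀ : Amb n) (homExt s)) x₀ :=
      hmax (Set.mem_univ (toSph y hy, toSph u hu))
    have hy0 : 0 < ‖y‖ := norm_pos_iff.2 hy
    have hu0 : 0 < ‖u‖ := norm_pos_iff.2 hu
    have h4 : dd (toSph u hu : Amb n) (dd (toSph u hu : Amb n) (homExt s)) (toSph y hy) =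
        ‖y‖ * (‖u‖⁻¹ * (‖u‖⁻¹ * dd u (dd u (homExt s)) y)) := by
      have e1 : (toSph u hu : Amb n) = ‖u‖⁻¹ • u := rfl
      have e2 : (toSph y hy : Amb n) = ‖y‖⁻¹ • y := rfl
      rw [e1, e2, dd_dd_homExt_smul _ (inv_pos.2 hy0) _ _ hy, inv_inv, dd_smul_left,
        dd_dd_homExt_smul_right hs _ _ _ hy]
    rw [h4] at h3
    have h5 := mul_le_mul_of_nonneg_right h3 (sq_nonneg ‖u‖)
    refine le_trans (le_of_eq ?_) h5
    field_simp

theorem IsEigenframe.hess_eq_sum (hs : ContMDiff (𝓡 n) 𝓘(ℝ, ℝ) 4 s) {x : Sph n}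
    {e : Fin n → Amb n} {l : Fin n → ℝ} (hF : IsEigenframe s x e l) (u : Amb n) :
    dd u (dd u (homExt s)) x = ∑ i, l i * inner ℝ (e i) u ^ 2 := by
  have h : dd u (dd u (homExt s)) x = dd (inner ℝ (x : Amb n) u • (x : Amb n) +
      ∑ i, inner ℝ (e i) u • e i) (dd u (homExt s)) x := by rw [← hF.expand u]
  rw [h, dd_add_left, dd_smul_left, dd_self_dd_homExt hs _ x.ne_zero, dd_sum_left, mul_zero,
    zero_add]
  refine Finset.sum_congr rfl fun i _ => ?_
  rw [dd_dd_homExt_comm hs _ _ x.ne_zero, hF.hess]; ring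

theorem IsEigenframe.norm_sq_eq_sum {x : Sph n} {e : Fin n → Amb n} {l : Fin n → ℝ}
    (hF : IsEigenframe s x e l) {u : Amb n} (hu : inner ℝ (x : Amb n) u = 0) :
    ‖u‖ ^ 2 = ∑ i, inner ℝ (e i) u ^ 2 := by
  have h : inner ℝ u u = inner ℝ u (inner ℝ (x : Amb n) u • (x : Amb n) +
      ∑ i, inner ℝ (e i) u • e i) := by rw [← hF.expand u]
  rw [← real_inner_self_eq_norm_sq, h, hu, zero_smul, zero_add, inner_sum]
  refine Finset.sum_congr rfl fun i _ => ?_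
  rw [real_inner_smul_right, real_inner_comm]; ring

/-- The upper bound for the eigenvalues of `τ[s]`, at the point where the largest eigenvalue is
maximal. -/
theorem hess_max_mul_le (hn : 1 ≤ n) (hs : ContMDiff (𝓡 n) 𝓘(ℝ, ℝ) 4 s)
    (hf : ContMDiff (𝓡 n) 𝓘(ℝ, ℝ) 2 f) (ht : TauPos s) (hk1 : 1 ≤ k) (hk : k ≤ n) (hp : 1 < p)
    (hspos : ∀ x, 0 < s x) (hsol : SolvesEq k p f s) (hm : 0 < m) (hfm : ∀ x, m ≤ f x)
    (hM : c2Norm f ≤ M) {σ N q : ℝ} (hσ : 0 < σ) (hσs : ∀ x, σ ≤ s x)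
    (hN : ∀ x : Sph n, gradSq s x ≤ N) (hq : 0 < q)
    (hqs : ∀ x, s x ^ (p - 1) * f x ≤ q⁻¹) {Λ : ℝ} {x₀ u₀ : Sph n}
    (hΛ : Λ = dd (u₀ : Amb n) (dd (u₀ : Amb n) (homExt s)) x₀)
    (hmax : ∀ (y : Amb n), y ≠ 0 → ∀ u : Amb n, ‖y‖ * dd u (dd u (homExt s)) y ≤ Λ * ‖u‖ ^ 2) :
    Λ * (min 1 (q / n.choose k) / n.choose k) ≤
      k + (p - 1) * (N / σ ^ 2 + 1) + M / m + (M / m) ^ 2 := by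
  obtain ⟨e, l, hF⟩ := exists_isEigenframe hs ht x₀
  have hx0 := x₀.ne_zero
  have hfpos : ∀ x, 0 < f x := fun x => hm.trans_le (hfm x)
  have hk' : k ≤ Fintype.card (Fin n) := by simpa using hk
  have hll := hF.dd_dd_self
  have hlΛ : ∀ i, l i ≤ Λ := fun i => by
    have := hmax x₀ hx0 (e i)
    rw [x₀.norm_eq, hF.orthonormal.norm_eq_one, hll] at this
    simpa using this
  have : Nonempty (Fin n) := ⟨⟨0, hn⟩⟩
  obtain ⟨j, hj⟩ := Finite.exists_max l
  have hΛ0 : 0 < Λ := (hF.pos j).trans_le (hlΛ j)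
  -- The maximizing direction `u₀` need not be tangent, but its radial part lies in the kernel of
  -- the Hessian, so Bessel's inequality bounds the Rayleigh quotient by the largest eigenvalue.
  have hlj : l j = Λ := by
    refine le_antisymm (hlΛ j) ?_
    rw [hΛ, hF.hess_eq_sum hs]
    calc ∑ i, l i * inner ℝ (e i) (u₀ : Amb n) ^ 2 ≤ ∑ i, l j * inner ℝ (e i) (u₀ : Amb n) ^ 2 :=
          Finset.sum_le_sum fun i _ => mul_le_mul_of_nonneg_right (hj i) (sq_nonneg _)
      _ = l j * ∑ i, inner ℝ (e i) (u₀ : Amb n) ^ 2 := by rw [Finset.mul_sum]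
      _ ≤ l j * 1 := by
          refine mul_le_mul_of_nonneg_left ?_ (hF.pos j).le
          have := hF.orthonormal.sum_inner_products_le (u₀ : Amb n) (s := Finset.univ)
          simpa [u₀.norm_eq] using this
      _ = l j := mul_one _
  have h4 : ∀ i, dd (e j) (dd (e j) (dd (e i) (dd (e i) (homExt s)))) x₀ ≤
      -((if i = j then 3 else 1) * Λ) := by
    intro i
    rw [dd_dd_dd_dd_homExt_comm hs _ _ hx0]
    have Jν := hasJet_sqrt_one_add_sq
    have Jh := hasJet_line isOpen_punctured (contDiffOn_dd_dd_homExt hs (e j) (e j)) hx0 (e i)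
    have hb : ∀ t : ℝ, √(1 + t ^ 2) * dd (e j) (dd (e j) (homExt s)) (x₀ + t • e i) ≤
        Λ * ‖e j‖ ^ 2 := fun t => by
      have := hmax _ (hF.line_ne_zero i t) (e j)
      rwa [hF.norm_line] at this
    by_cases h : i = j
    · subst h
      have J := ((Jν.mul Jν).mul Jν).mul Jh
      have := (J.of_isLocalMax (Filter.Eventually.of_forall fun t => by
        have hy0 := hF.line_ne_zero i t
        have hν0 : 0 < √(1 + t ^ 2) := Real.sqrt_pos.2 (by positivity)
        have hν2 : √(1 + t ^ 2) ^ 2 = 1 + t ^ 2 := Real.sq_sqrt (by positivity)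
        set ν := √(1 + t ^ 2) with hν
        -- When `i = j`, removing the radial part shortens `e i` to length `1/ν` without changing
        -- the Hessian value. The bound improves from `ν` to `ν³`, and the resulting constant `3`
        -- matches the one in the differentiated equation.
        have h1 := hmax _ hy0 (e i + (-(t / ν ^ 2)) • ((x₀ : Amb n) + t • e i))
        rw [dd_dd_homExt_add_smul_self hs _ _ hy0, hF.norm_line, ← hν] at h1
        have h2 : ‖e i + (-(t / ν ^ 2)) • ((x₀ : Amb n) + t • e i)‖ ^ 2 = 1 / ν ^ 2 := by
          have hei : inner ℝ (e i) ((x₀ : Amb n) + t • e i) = t := by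
            rw [inner_add_right, real_inner_smul_right, real_inner_self_eq_norm_sq,
              hF.orthonormal.norm_eq_one, real_inner_comm, hF.inner_base]
            simp
          rw [norm_add_sq_real, norm_smul, hF.norm_line, ← hν, real_inner_smul_right, hei,
            hF.orthonormal.norm_eq_one, mul_pow, Real.norm_eq_abs, sq_abs]
          have : t ^ 2 = ν ^ 2 - 1 := by linarith
          field_simp
          rw [this]; ring
        rw [h2] at h1
        have h3 := mul_le_mul_of_nonneg_right h1 (sq_nonneg ν)
        have h5 : Λ * (1 / ν ^ 2) * ν ^ 2 = Λ := by field_simp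
        rw [h5] at h3
        simp only [zero_smul, add_zero, hll, hlj]
        have h6 : √(1 + (0 : ℝ) ^ 2) = 1 := by simp
        rw [h6]
        linarith)).2
      simp only [if_true, hll, hlj] at this ⊢
      linarith
    · have J := Jν.mul Jh
      have := (J.of_isLocalMax (Filter.Eventually.of_forall fun t => by
        have h1 := hb t
        rw [hF.orthonormal.norm_eq_one] at h1
        simp only [zero_smul, add_zero, hll, hlj]
        have h6 : √(1 + (0 : ℝ) ^ 2) = 1 := by simp
        rw [h6]
        linarith)).2
      simp only [if_neg h, hll, hlj] at this ⊢
      linarith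
  have hw0 : ∀ i, 0 ≤ invWeight k l i := invWeight_nonneg hk' hF.pos
  have hrhs : ∑ i, invWeight k l i * (dd (e j) (dd (e j) (dd (e i) (dd (e i) (homExt s)))) x₀ +
      (if i = j then 3 else 1) * l i) ≤ k - Λ * ∑ i, invWeight k l i := by
    rw [← sum_invWeight_mul_self hk' hF.pos, Finset.mul_sum, ← Finset.sum_sub_distrib]
    refine Finset.sum_le_sum fun i _ => ?_
    -- For `i = j` both sides of the resulting bound vanish, as `l j = Λ`, so the case needs no
    -- separate treatment in the sum.
    have h1 : dd (e j) (dd (e j) (dd (e i) (dd (e i) (homExt s)))) x₀ +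
        (if i = j then 3 else 1) * l i ≤ l i - Λ := by
      have := h4 i
      by_cases h : i = j
      · subst h
        simp only [if_true, hlj] at this ⊢
        linarith
      · simp only [if_neg h] at this ⊢
        linarith
    calc _ ≤ invWeight k l i * (l i - Λ) := mul_le_mul_of_nonneg_left h1 (hw0 i)
      _ = _ := by ring
  have h2 := (hF.derivatives hs hf ht hk hspos hfpos hsol j).2.trans hrhs
  have hM1 : 0 ≤ M := by
    have := (c2Norm_bounds hf hM x₀).1
    exact (abs_nonneg _).trans this
  have hff : -(M / m) ≤ dd (e j) (dd (e j) (radialExt f)) x₀ / f x₀ := by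
    have h1 := abs_dd_dd_radialExt_le hf hM x₀ (hF.inner_base j) (hF.orthonormal.norm_eq_one j)
    have h3 : |dd (e j) (dd (e j) (radialExt f)) x₀ / f x₀| ≤ M / m := by
      rw [abs_div, abs_of_pos (hfpos x₀)]
      exact div_le_div₀ hM1 h1 hm (hfm x₀)
    exact (abs_le.1 h3).1
  have hf1 : (dd (e j) (radialExt f) x₀ / f x₀) ^ 2 ≤ (M / m) ^ 2 := by
    have h1 := abs_dd_radialExt_le hf hM x₀ (e j)
    rw [hF.orthonormal.norm_eq_one, mul_one] at h1
    refine sq_le_sq' ?_ ?_ <;>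
    · have h3 : |dd (e j) (radialExt f) x₀ / f x₀| ≤ M / m := by
        rw [abs_div, abs_of_pos (hfpos x₀)]
        exact div_le_div₀ hM1 h1 hm (hfm x₀)
      have := abs_le.1 h3
      linarith
  have hg : (dd (e j) (homExt s) x₀ / s x₀) ^ 2 ≤ N / σ ^ 2 := by
    have h1 := sq_le_gradSq hs x₀ (hF.orthonormal.norm_eq_one j) (hF.inner_base j)
    have h3 := hN x₀
    have h5 := sq_nonneg (s x₀)
    have h6 := sq_nonneg (dd (e j) (homExt s) x₀)
    rw [div_pow]
    exact div_le_div₀ (by linarith) (by linarith) (by positivity)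
      (pow_le_pow_left₀ hσ.le (hσs x₀) 2)
  have hq' : q ≤ invEsymm k l := by
    have h1 := hqs x₀
    rw [hF.solves hk hsol] at h1
    exact (inv_le_inv₀ (invEsymm_pos hk' hF.pos) hq).1 h1
  have hsum := le_sum_invWeight hk1 hk' hF.pos hq hq'
  rw [Fintype.card_fin] at hsum
  have h7 := mul_le_mul_of_nonneg_left hsum hΛ0.le
  have h8 : 0 ≤ l j / s x₀ := (div_pos (hF.pos j) (hspos x₀)).le
  -- The term `(p - 1) l_j / s` has the favourable sign and is dropped.
  have h9 : -((p - 1) * (N / σ ^ 2 + 1)) ≤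
      (p - 1) * (l j / s x₀ - (dd (e j) (homExt s) x₀ / s x₀) ^ 2 - 1) := by
    rw [← mul_neg]
    exact mul_le_mul_of_nonneg_left (by linarith) (by linarith)
  linarith

end SecondOrder

/-! ### From eigenvalue bounds to norms. -/

section Norms

variable {n : ℕ} {s : Sph n → ℝ}

/-- The spherical gradient is tangent by homogeneity of degree `0`, and in tangent directions the
two extensions have the same derivative; Cauchy–Schwarz against the ambient gradient concludes. -/
theorem norm_sphereGrad_le (hs : ContMDiff (𝓡 n) 𝓘(ℝ, ℝ) 4 s) (x : Sph n) :
    ‖sphereGrad s (x : Amb n)‖ ≤ √(gradSq s x) := by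
  obtain ⟨w, -, hw, hN⟩ := exists_gradient s (x : Amb n)
  rw [hN, Real.sqrt_sq (norm_nonneg _)]
  set v := sphereGrad s (x : Amb n) with hv
  have hx0 := x.ne_zero
  have hr : DifferentiableAt ℝ (radialExt s) (x : Amb n) :=
    (contDiffOn_radialExt hs).differentiableAt_punctured (by norm_num) hx0
  have hxv : inner ℝ (x : Amb n) v = 0 := by
    rw [real_inner_comm, inner_sphereGrad, (posHomog_radialExt s).dd_self hx0 hr]
    simp
  have h1 : dd v (homExt s) x = dd v (radialExt s) x := by
    have : dd v (homExt s) x = _ := dd_mul (differentiableAt_fun_id.norm ℝ hx0) hr v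
    rw [this, dd_norm hx0, hxv, x.norm_eq]
    simp
  have h2 : ‖v‖ ^ 2 = inner ℝ v w := by
    rw [hw, h1, ← inner_sphereGrad, real_inner_self_eq_norm_sq]
  have h3 : ‖v‖ ^ 2 ≤ ‖v‖ * ‖w‖ := h2.trans_le (real_inner_le_norm v w)
  by_cases h0 : ‖v‖ = 0
  · rw [h0]; exact norm_nonneg w
  · have h4 : 0 < ‖v‖ := lt_of_le_of_ne (norm_nonneg v) (Ne.symm h0)
    rw [sq] at h3
    exact le_of_mul_le_mul_left h3 h4

theorem IsEigenframe.norm_sphereHess_le (hs : ContMDiff (𝓡 n) 𝓘(ℝ, ℝ) 4 s) {x : Sph n}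
    {e : Fin n → Amb n} {l : Fin n → ℝ} (hF : IsEigenframe s x e l) {c : ℝ} (hc : 0 ≤ c)
    (hl : ∀ i, l i ≤ c) : ‖sphereHess s x‖ ≤ c + |s x| := by
  have h1 : ∀ u : TanSp x, ‖tau s x u‖ ≤ c * ‖u‖ := by
    intro u
    have h2 : ∀ i, inner ℝ (e i) (tau s x u : Amb n) = l i * inner ℝ (e i) (u : Amb n) := by
      intro i
      let ei : TanSp x := ⟨e i, mem_tanSp.2 (hF.inner_base i)⟩
      have h3 := inner_tau_homExt hs x u ei
      change inner ℝ (tau s x u : Amb n) (e i) = dd (u : Amb n) (dd (e i) (homExt s)) x at h3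
      rw [real_inner_comm, h3, hF.hess]
    have h4 := hF.norm_sq_eq_sum (mem_tanSp.1 (tau s x u).2)
    have h5 := hF.norm_sq_eq_sum (mem_tanSp.1 u.2)
    refine le_of_sq_le_sq ?_ (by positivity)
    rw [mul_pow]
    change ‖(tau s x u : Amb n)‖ ^ 2 ≤ c ^ 2 * ‖(u : Amb n)‖ ^ 2
    rw [h4, h5, Finset.mul_sum]
    refine Finset.sum_le_sum fun i _ => ?_
    rw [h2, mul_pow]
    exact mul_le_mul_of_nonneg_right (pow_le_pow_left₀ (hF.pos i).le (hl i) 2) (sq_nonneg _)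
  refine ContinuousLinearMap.opNorm_le_bound _ (by positivity) fun u => ?_
  have h2 : sphereHess s x u = tau s x u - s x • u := by simp [tau]
  rw [h2]
  calc ‖tau s x u - s x • u‖ ≤ ‖tau s x u‖ + ‖s x • u‖ := norm_sub_le _ _
    _ ≤ c * ‖u‖ + |s x| * ‖u‖ := by
        rw [norm_smul, Real.norm_eq_abs]
        exact add_le_add (h1 u) le_rfl
    _ = (c + |s x|) * ‖u‖ := by ring

theorem IsEigenframe.le_inner_tau (hs : ContMDiff (𝓡 n) 𝓘(ℝ, ℝ) 4 s) {x : Sph n}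
    {e : Fin n → Amb n} {l : Fin n → ℝ} (hF : IsEigenframe s x e l) {c : ℝ}
    (hl : ∀ i, c ≤ l i) (u : TanSp x) : c * ‖u‖ ^ 2 ≤ inner ℝ (tau s x u) u := by
  rw [inner_tau_homExt hs, hF.hess_eq_sum hs]
  change c * ‖(u : Amb n)‖ ^ 2 ≤ _
  rw [hF.norm_sq_eq_sum (mem_tanSp.1 u.2), Finset.mul_sum]
  exact Finset.sum_le_sum fun i _ => mul_le_mul_of_nonneg_right (hl i) (sq_nonneg _)

end Norms

/-! ### Assembling the estimates. -/

/-- Zeroth and first order estimates. -/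
theorem exists_c1_bound (n k : ℕ) (hn : 1 ≤ n) (hk1 : 1 ≤ k) (hk : k ≤ n) (p : ℝ)
    (hpk : p < (k : ℝ) + 1) (γ : ℝ) (hγ : 0 < γ) (hγp : γ < 2 * (p - 1) / (k : ℝ))
    (m M : ℝ) (hm : 0 < m) (hmM : m ≤ M) :
    ∃ a b N : ℝ, 0 < a ∧ 0 < b ∧ ∀ f s : Sph n → ℝ,
      ContMDiff (𝓡 n) 𝓘(ℝ, ℝ) 2 f → (∀ x, m ≤ f x) → c2Norm f ≤ M →
      ContMDiff (𝓡 n) 𝓘(ℝ, ℝ) 4 s → IsEven s → TauPos s → SolvesEq k p f s →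
        ∀ x : Sph n, a ≤ s x ∧ s x ≤ b ∧ gradSq s x ≤ N := by
  have hk0 : (0 : ℝ) < k := by exact_mod_cast hk1
  have hγk : γ * k < 2 * (p - 1) := (lt_div_iff₀ hk0).1 hγp
  -- This is where `p < k + 1` enters the gradient estimate: it makes `2(p-1)/k < 2`.
  have hγ2 : γ < 2 := by
    have : γ * k < 2 * k := hγk.trans (by linarith)
    exact lt_of_mul_lt_mul_right this hk0.le
  set A := 1 + ((2 * (M / m) + (2 + γ) * k) / (2 * (p - 1) - γ * k) + 1) ^ 2 with hA
  have hA1 : 1 ≤ A := by rw [hA]; linarith [sq_nonneg ((2 * (M / m) + (2 + γ) * k) /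
    (2 * (p - 1) - γ * k) + 1)]
  obtain ⟨c, hc0, hc⟩ := exists_mul_max_le hA1 hγ hγ2
  have hM0 : 0 < M := hm.trans_le hmM
  have hch : (0 : ℝ) < n.choose k := by exact_mod_cast Nat.choose_pos hk
  set d : ℝ := (k : ℝ) + 1 - p with hd
  have hd0 : 0 < d := by rw [hd]; linarith
  -- The bound for the minimum of `s` divided by the Harnack ratio `c`; dually, the lower bound `a`
  -- is `c` times the bound for the maximum.
  set b : ℝ := (n.choose k * M) ^ (1 / d) / c with hb
  have hb0 : 0 < b := by positivity
  refine ⟨c * m ^ (1 / d), b, A * b ^ 2, by positivity, hb0, ?_⟩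
  intro f s hf hfm hM hs he ht hsol x
  have hspos := support_pos hn hs he ht
  obtain ⟨x₀, -, hx₀⟩ := isCompact_univ.exists_isMaxOn (⟨x, Set.mem_univ x⟩ : Set.univ.Nonempty)
    hs.continuous.continuousOn
  obtain ⟨x₁, -, hx₁⟩ := isCompact_univ.exists_isMinOn (⟨x, Set.mem_univ x⟩ : Set.univ.Nonempty)
    hs.continuous.continuousOn
  have hmax : ∀ z, s z ≤ s x₀ := fun z => hx₀ (Set.mem_univ z)
  have hmin : ∀ z, s x₁ ≤ s z := fun z => hx₁ (Set.mem_univ z)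
  have hgrad := gradSq_le hn hs hf ht hk hspos hsol hm hfm hM hγ hγ2 hγk hmax
  have hratio := hc n s hn hs ht he hspos x₀ hmax hgrad
  have h1 : m ^ (1 / d) ≤ s x₀ := by
    have := (hfm x₀).trans (le_rpow_of_isMax hs ht hk hspos hsol hmax)
    have h2 := Real.rpow_le_rpow hm.le this (by positivity : 0 ≤ 1 / d)
    rwa [← Real.rpow_mul (hspos x₀).le, mul_one_div_cancel hd0.ne', Real.rpow_one] at h2
  have h2 : s x₁ ≤ (n.choose k * M) ^ (1 / d) := by
    have h3 := rpow_le_of_isMin hs ht hk hspos hsol hmin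
    have h4 : f x₁ ≤ M := (le_abs_self _).trans (c2Norm_bounds hf hM x₁).1
    have h5 := h3.trans (mul_le_mul_of_nonneg_left h4 hch.le)
    have h6 := Real.rpow_le_rpow (Real.rpow_nonneg (hspos x₁).le _) h5
      (by positivity : 0 ≤ 1 / d)
    rwa [← Real.rpow_mul (hspos x₁).le, mul_one_div_cancel hd0.ne', Real.rpow_one] at h6
  have h3 : s x₀ ≤ b := by
    rw [hb, le_div_iff₀ hc0, mul_comm]
    exact (hratio x₁).trans h2
  refine ⟨(mul_le_mul_of_nonneg_left h1 hc0.le).trans (hratio x), (hmax x).trans h3, ?_⟩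
  calc gradSq s x ≤ A * s x₀ ^ (2 - γ) * s x ^ γ := hgrad x
    _ ≤ A * s x₀ ^ (2 - γ) * s x₀ ^ γ := by
        refine mul_le_mul_of_nonneg_left (Real.rpow_le_rpow (hspos x).le (hmax x) hγ.le) ?_
        exact mul_nonneg (by linarith) (Real.rpow_nonneg (hspos _).le _)
    _ = A * s x₀ ^ 2 := by
        rw [mul_assoc, ← Real.rpow_add (hspos x₀)]; norm_num
    _ ≤ A * b ^ 2 := mul_le_mul_of_nonneg_left (pow_le_pow_left₀ (hspos _).le h3 2) (by linarith)

theorem mainTheorem2 (n k : ℕ) (hk : 1 ≤ k) (hkn : k < n) (p : ℝ) (hp : 1 < p)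
    (hpk : p < (k : ℝ) + 1) (γ : ℝ) (hγ : 0 < γ) (hγp : γ < 2 * (p - 1) / (k : ℝ))
    (m : ℝ) (hm : 0 < m) (M : ℝ) :
    ∃ C : ℝ, 0 < C ∧
      ∀ f s : Sph n → ℝ,
        ContMDiff (𝓡 n) 𝓘(ℝ, ℝ) 2 f → (∀ x, m ≤ f x) → c2Norm f ≤ M →
        ContMDiff (𝓡 n) 𝓘(ℝ, ℝ) 4 s → IsEven s → TauPos s → SolvesEq k p f s →
          (∀ x, 1 / C ≤ s x ∧ s x ≤ C) ∧ TauGe s (1 / C) ∧ c2Norm s ≤ C := by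
  have hne := nonempty_sph n
  have hn : 1 ≤ n := by omega
  -- If `M < m` no admissible `f` exists, and any constant will do.
  rcases lt_or_ge M m with hMm | hmM
  · refine ⟨1, one_pos, fun f s hf hfm hM => ?_⟩
    obtain ⟨x⟩ := hne
    have h1 := (le_abs_self _).trans (c2Norm_bounds hf hM x).1
    linarith [hfm x]
  obtain ⟨a, b, N, ha, hb, hc1⟩ :=
    exists_c1_bound n k hn hk hkn.le p hpk γ hγ hγp m M hm hmM
  have hM0 : 0 < M := hm.trans_le hmM
  have hch : (0 : ℝ) < n.choose k := by exact_mod_cast Nat.choose_pos hkn.le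
  set q : ℝ := (b ^ (p - 1) * M)⁻¹ with hq
  have hq0 : 0 < q := by positivity
  set w : ℝ := min 1 (q / n.choose k) / n.choose k with hw
  have hw0 : 0 < w := div_pos (lt_min one_pos (by positivity)) hch
  set Λ₀ : ℝ := max 1 ((k + (p - 1) * (N / a ^ 2 + 1) + M / m + (M / m) ^ 2) / w) with hΛ₀
  have hΛ₀0 : 0 < Λ₀ := one_pos.trans_le (le_max_left _ _)
  -- A bound for the reciprocal eigenvalues, from `le_mul_invEsymm` with `invEsymm` bounded through
  -- the equation.
  set κ : ℝ := (a ^ (p - 1) * m)⁻¹ * Λ₀ ^ (k - 1) with hκ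
  have hκ0 : 0 < κ := by positivity
  -- A sum of nonnegative terms dominating every required bound; `b` occurs twice because it bounds
  -- `|s|` and also enters when the Hessian is recovered as `τ[s] - s g`.
  set C : ℝ := 1 / a + κ + 2 * b + √N + Λ₀ with hC
  have hsq : 0 ≤ √N := Real.sqrt_nonneg N
  have h1a : 0 < 1 / a := by positivity
  have hC0 : 0 < C := by rw [hC]; positivity
  refine ⟨C, hC0, fun f s hf hfm hM hs he ht hsol => ?_⟩
  have hc := hc1 f s hf hfm hM hs he ht hsol
  have hspos := support_pos hn hs he ht
  obtain ⟨x₀, u₀, hmax⟩ := exists_max_hess hs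
  have hqs : ∀ x, s x ^ (p - 1) * f x ≤ q⁻¹ := fun x => by
    rw [hq, inv_inv]
    refine mul_le_mul (Real.rpow_le_rpow (hspos x).le (hc x).2.1 (by linarith))
      ((le_abs_self _).trans (c2Norm_bounds hf hM x).1) (hm.le.trans (hfm x)) (by positivity)
  have hΛ := hess_max_mul_le hn hs hf ht hk hkn.le hp hspos hsol hm hfm hM ha
    (fun x => (hc x).1) (fun x => (hc x).2.2) hq0 hqs rfl hmax
  set Λ := dd (u₀ : Amb n) (dd (u₀ : Amb n) (homExt s)) x₀ with hΛdef
  have hΛle : Λ ≤ Λ₀ := ((le_div_iff₀ hw0).2 hΛ).trans (le_max_right _ _)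
  have hF : ∀ x, ∃ e l, IsEigenframe s x e l ∧ ∀ i, κ⁻¹ ≤ l i ∧ l i ≤ Λ₀ := by
    intro x
    obtain ⟨e, l, hF⟩ := exists_isEigenframe hs ht x
    have hk' : k ≤ Fintype.card (Fin n) := by simpa using hkn.le
    have hl : ∀ i, l i ≤ Λ₀ := fun i => by
      have := hmax x x.ne_zero (e i)
      rw [x.norm_eq, hF.orthonormal.norm_eq_one, hF.dd_dd_self] at this
      linarith
    refine ⟨e, l, hF, fun i => ⟨?_, hl i⟩⟩
    have h1 := le_mul_invEsymm hk hk' hF.pos hl i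
    have h2 : invEsymm k l ≤ (a ^ (p - 1) * m)⁻¹ := by
      rw [← inv_inv (invEsymm k l), ← hF.solves hkn.le hsol]
      refine inv_anti₀ (by positivity) ?_
      exact mul_le_mul (Real.rpow_le_rpow ha.le (hc x).1 (by linarith)) (hfm x) hm.le
        (Real.rpow_nonneg (hspos x).le _)
    have h3 : (l i)⁻¹ ≤ κ := h1.trans (mul_le_mul_of_nonneg_right h2 (by positivity))
    exact inv_le_of_inv_le₀ (hF.pos i) h3
  refine ⟨fun x => ⟨?_, ?_⟩, fun x u => ?_, ?_⟩
  · refine le_trans ?_ (hc x).1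
    rw [one_div_le hC0 ha, hC]
    linarith
  · refine (hc x).2.1.trans ?_
    rw [hC]; linarith
  · obtain ⟨e, l, hF, hl⟩ := hF x
    refine hF.le_inner_tau hs (fun i => le_trans ?_ (hl i).1) u
    rw [one_div]
    refine inv_anti₀ hκ0 ?_
    rw [hC]; linarith
  · have h1 : ⨆ x : Sph n, |s x| ≤ b := ciSup_le fun x => by
      rw [abs_of_pos (hspos x)]; exact (hc x).2.1
    have h2 : ⨆ x : Sph n, ‖sphereGrad s (x : Amb n)‖ ≤ √N := ciSup_le fun x =>
      (norm_sphereGrad_le hs x).trans (Real.sqrt_le_sqrt (hc x).2.2)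
    have h3 : ⨆ x : Sph n, ‖sphereHess s x‖ ≤ Λ₀ + b := ciSup_le fun x => by
      obtain ⟨e, l, hF, hl⟩ := hF x
      refine (hF.norm_sphereHess_le hs hΛ₀0.le fun i => (hl i).2).trans ?_
      rw [abs_of_pos (hspos x)]
      linarith [(hc x).2.1]
    unfold c2Norm
    rw [hC]
    linarith
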